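/- Let $I=[0,1]$ with Lebesgue measure. A graphon is a symmetric Lebesgue measurable function $W:I^2\to[0,1]$. A graphon $\Gamma'$ is a version of a graphon $\Gamma$ if there is a measure-preserving almost-bijection $\gamma:I\to I$ (a measure-preserving map restricting to a bijection between two conull sets) such that $\Gamma'(x,y)=\Gamma(\gamma^{-1}(x),\gamma^{-1}(y))$ for almost every $(x,y)\in I^2$. Weak$^*$ convergence of graphons is that of $L^\infty(I^2)=(L^1(I^2))^*$, and the cut-norm is $\|U\|_\square=\sup_{A\subset I\text{ measurable}}\left|\int_A\int_A U(x,y)\,dx\,dy\right|$. An accumulation point of a sequence is a limit of one of its subsequences. For a sequence of graphons $\Gamma_1,\Gamma_2,\ldots$ let $\mathrm{ACC}(\Gamma_1,\Gamma_2,\ldots)$ be the set of graphons $W$ for which there are versions $\Gamma_n'$ of $\Gamma_n$ ($n\ge1$) such that $W$ is a weak$^*$ accumulation point of $\Gamma'_1,\Gamma'_2,\ldots$. We say that $W$ is an accumulation point of $\Gamma_1,\Gamma_2,\ldots$ in the cut-norm, up to versions, if there are versions $\Gamma_n'$ of $\Gamma_n$ ($n\ge1$) such that $W$ is an accumulation point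 of $\Gamma'_1,\Gamma'_2,\ldots$ in the cut-norm. For $f:[0,1]\to\mathbb R$ put $\mathrm{INT}_f(W)=\int_I\int_I f(W(x,y))\,dx\,dy$. Theorem. Let $f:[0,1]\to\mathbb R$ be continuous and strictly concave, and let $\Gamma_1,\Gamma_2,\ldots$ be a sequence of graphons. (a) If $W\in\mathrm{ACC}(\Gamma_1,\Gamma_2,\ldots)$ is not an accumulation point of $\Gamma_1,\Gamma_2,\ldots$ in the cut-norm, up to versions, then there exists $\widetilde W\in\mathrm{ACC}(\Gamma_1,\Gamma_2,\ldots)$ with $\mathrm{INT}_f(\widetilde W)<\mathrm{INT}_f(W)$. (b) There exist a subsequence $\Gamma_{k_1},\Gamma_{k_2},\ldots$ (with $k_1<k_2<\cdots$) and a graphon $W_{\min}\in\mathrm{ACC}(\Gamma_{k_1},\Gamma_{k_2},\ldots)$ such that $$\mathrm{INT}_f(W_{\min})=\inf\{\mathrm{INT}_f(W): W\in\mathrm{ACC}(\Gamma_{k_1},\Gamma_{k_2},\ldots)\}.$$ -/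

import Mathlib

open MeasureTheory Filter Topology

noncomputable section

/-- A graphon: a symmetric Lebesgue measurable function from the unit square to `[0, 1]`.
The square `unitInterval × unitInterval` carries the two-dimensional Lebesgue measure `volume`;
a function is Lebesgue measurable iff it is almost everywhere equal to a Borel function. -/
structure Graphon where
  toFun : unitInterval × unitInterval → ℝ
  lebesgueMeasurable : AEMeasurable toFun volume
  symmetric : ∀ x y, toFun (x, y) = toFun (y, x)
  mem_Icc : ∀ p, toFun p ∈ Set.Icc (0 : ℝ) 1

instance : CoeFun Graphon (fun _ => unitInterval × unitInterval → ℝ) := ⟨Graphon.toFun⟩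

namespace Graphon

/-- `γ` is a measure-preserving almost-bijection of the unit interval with inverse `δ`: it
restricts to a bijection between conull sets `J₁` and `J₂`, and `δ` inverts it there (so `δ` is
determined by `γ` up to a null set). -/
def IsAlmostBijectionWithInverse (γ δ : unitInterval → unitInterval) : Prop :=
  MeasurePreserving γ volume volume ∧
    ∃ J₁ ∈ ae (volume : Measure unitInterval), ∃ J₂ ∈ ae (volume : Measure unitInterval),
      Set.BijOn γ J₁ J₂ ∧ Set.LeftInvOn δ γ J₁

/-- `Γ'` is a version of `Γ`: `Γ'(x, y) = Γ(γ⁻¹(x), γ⁻¹(y))` for almost every `(x, y)`, for some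
measure-preserving almost-bijection `γ`. -/
def IsVersion (Γ' Γ : Graphon) : Prop :=
  ∃ γ δ : unitInterval → unitInterval, IsAlmostBijectionWithInverse γ δ ∧
    ∀ᵐ p : unitInterval × unitInterval, Γ' p = Γ (δ p.1, δ p.2)

/-- Weak* convergence in `L^∞` of the square, as the dual of `L^1` of the square. -/
def WeakStarTendsto (Γ : ℕ → Graphon) (W : Graphon) : Prop :=
  ∀ g : unitInterval × unitInterval → ℝ, Integrable g volume →
    Tendsto (fun n => ∫ p, g p * Γ n p) atTop (𝓝 (∫ p, g p * W p))

/-- The cut-norm `sup_A |∫_A ∫_A U|`, with `A` ranging over the measurable subsets of the unit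
interval. -/
def cutNorm (U : unitInterval × unitInterval → ℝ) : ℝ :=
  ⨆ A : {A : Set unitInterval // MeasurableSet A}, |∫ p in (A : Set unitInterval) ×ˢ (A : Set unitInterval), U p|

/-- `ACC(Γ)`: the graphons `W` for which there are versions `Γ'_n` of `Γ_n` such that `W` is a
weak* accumulation point of the sequence `Γ'`, that is, the weak* limit of a subsequence of it. -/
def ACC (Γ : ℕ → Graphon) : Set Graphon :=
  {W | ∃ Γ' : ℕ → Graphon, (∀ n, IsVersion (Γ' n) (Γ n)) ∧
    ∃ k : ℕ → ℕ, StrictMono k ∧ WeakStarTendsto (fun n => Γ' (k n)) W}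

/-- `W` is an accumulation point of the sequence of graphons in the cut-norm, where, as in `ACC`,
graphons are taken up to versions: there are versions `Γ'_n` of `Γ_n` a subsequence
of which converges to `W` in the cut-norm. -/
def IsCutNormAccPt (Γ : ℕ → Graphon) (W : Graphon) : Prop :=
  ∃ Γ' : ℕ → Graphon, (∀ n, IsVersion (Γ' n) (Γ n)) ∧
    ∃ k : ℕ → ℕ, StrictMono k ∧
      Tendsto (fun n => cutNorm (fun p => Γ' (k n) p - W p)) atTop (𝓝 0)

/-- `INT_f(W) = ∫∫ f(W(x, y)) dx dy`. -/
def INT (f : ℝ → ℝ) (W : Graphon) : ℝ :=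
  ∫ p, f (W p)

end Graphon

end

/-!
The idea is that a weak* limit `W` of graphons `G n` which is not a cut norm limit can be refined.
Choose sets `A n` on which `G n - W` has a large integral over `A n × A n`, and sort the points of the
interval so that `A n` becomes an initial segment. The points `x` of the limit then come in two copies,
with weights `ψ (true, x)` and `ψ (false, x)`, where `ψ` is the weak* limit of the indicators of `A n`
and of its complement. A weak* limit `W'` of the sorted graphons lives on this doubled interval, and
`W (x, y)` is the average of the four values of `W'` at the copies of `x` and `y`
(`Graphon.exists_refinement`). The choice of `A n` forces the average to be nontrivial, so strict
concavity and Jensen's inequality give `INT f W' < INT f W` (`Graphon.Refinement.INT_lt`), which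
is the first assertion. For the average to be an honest one, no information on the doubled interval may
be lost by sorting: the rank function is invertible modulo null sets (`exists_aeInverse_unitCdf`), so
that testing against functions of the ranks determines everything (`Graphon.split_limit_ae_eq`).

For the second assertion, the same refinement applied to `t ↦ t ^ 2` gains a definite amount
(`Graphon.Refinement.INT_sq_add_le`), hence a weak* limit with almost maximal `∫∫ W ^ 2` is close in the
cut norm to infinitely many terms of the sequence, up to versions. A diagonal argument and the weak*
lower semicontinuity of the cut norm turn this into sequential compactness of the space of graphons in
the cut distance (`Graphon.exists_subseq_cutDist_tendsto`). Finally, if a sequence converges in the cut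
norm to `U` up to versions, then each of its weak* accumulation points is a weak* limit of versions of
`U`, and `INT f` is weak* upper semicontinuous and invariant under versions, so that `U` is a
minimiser (`Graphon.INT_le_of_mem_ACC`).
-/

noncomputable section

/-! ### Weak* convergence of bounded functions -/

/-- Weak* convergence of `u n` to `v` in `L^∞(μ)`, tested against integrable functions. -/
def WeakStarLim {X : Type*} [MeasurableSpace X] (μ : Measure X) (u : ℕ → X → ℝ) (v : X → ℝ) : Prop :=
  ∀ g : X → ℝ, Integrable g μ → Tendsto (fun n => ∫ x, g x * u n x ∂μ) atTop (𝓝 (∫ x, g x * v x ∂μ))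

section WeakStar

variable {X : Type*} [MeasurableSpace X] {μ : Measure X}

theorem abs_le_one_of_mem_Icc {t : ℝ} (h : t ∈ Set.Icc (0 : ℝ) 1) : |t| ≤ 1 :=
  abs_le.2 ⟨by linarith [h.1], h.2⟩

theorem integrable_mul_of_abs_le_one {g u : X → ℝ} (hg : Integrable g μ) (hu : AEMeasurable u μ)
    (hb : ∀ x, |u x| ≤ 1) : Integrable (fun x => g x * u x) μ :=
  hg.mul_bdd (c := 1) hu.aestronglyMeasurable (ae_of_all _ hb)

theorem integrable_of_abs_le_one [IsFiniteMeasure μ] {u : X → ℝ} (hu : AEMeasurable u μ)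
    (hb : ∀ x, |u x| ≤ 1) : Integrable u μ :=
  Integrable.of_bound hu.aestronglyMeasurable 1 (ae_of_all _ hb)

theorem abs_integral_mul_sub_le {g h u : X → ℝ} (hg : Integrable g μ) (hh : Integrable h μ)
    (hu : AEMeasurable u μ) (hb : ∀ x, |u x| ≤ 1) :
    |∫ x, g x * u x ∂μ - ∫ x, h x * u x ∂μ| ≤ ∫ x, |g x - h x| ∂μ := by
  rw [← integral_sub (integrable_mul_of_abs_le_one hg hu hb) (integrable_mul_of_abs_le_one hh hu hb)]
  refine (abs_integral_le_integral_abs).trans (integral_mono_of_nonneg (ae_of_all _ fun x => abs_nonneg _)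
    (hg.sub hh).abs (ae_of_all _ fun x => ?_))
  simp only [← sub_mul, abs_mul]
  exact mul_le_of_le_one_right (abs_nonneg _) (hb x)

/-- Indicators of sets of finite measure suffice as test functions, by density in `L^1`. -/
theorem weakStarLim_of_setIntegral {u : ℕ → X → ℝ} {v : X → ℝ}
    (hu : ∀ n, AEMeasurable (u n) μ) (hub : ∀ n x, |u n x| ≤ 1)
    (hv : AEMeasurable v μ) (hvb : ∀ x, |v x| ≤ 1)
    (h : ∀ s, MeasurableSet s → μ s < ⊤ →
      Tendsto (fun n => ∫ x in s, u n x ∂μ) atTop (𝓝 (∫ x in s, v x ∂μ))) :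
    WeakStarLim μ u v := by
  intro g hg
  refine Integrable.induction (P := fun g : X → ℝ =>
    Tendsto (fun n => ∫ x, g x * u n x ∂μ) atTop (𝓝 (∫ x, g x * v x ∂μ))) ?_ ?_ ?_ ?_ hg
  · intro c s hs hμs
    have key : ∀ w : X → ℝ, ∫ x, s.indicator (fun _ => c) x * w x ∂μ = c * ∫ x in s, w x ∂μ := by
      intro w
      rw [← integral_const_mul, ← integral_indicator hs]
      refine integral_congr_ae (ae_of_all _ fun x => ?_)
      by_cases hx : x ∈ s <;> simp [hx]
    simp only [key]
    exact (h s hs hμs).const_mul c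
  · intro f g _ hf hg Hf Hg
    have key : ∀ w : X → ℝ, AEMeasurable w μ → (∀ x, |w x| ≤ 1) →
        ∫ x, (f + g) x * w x ∂μ = ∫ x, f x * w x ∂μ + ∫ x, g x * w x ∂μ := by
      intro w hw hb
      rw [← integral_add (integrable_mul_of_abs_le_one hf hw hb) (integrable_mul_of_abs_le_one hg hw hb)]
      simp [add_mul]
    rw [key v hv hvb]
    simp only [fun n => key (u n) (hu n) (hub n)]
    exact Hf.add Hg
  · rw [← isSeqClosed_iff_isClosed]
    intro fs f hfs hf
    simp only [Set.mem_ofPred_eq] at hfs ⊢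
    rw [Metric.tendsto_atTop]
    intro ε hε
    have hf' := (tendsto_iff_norm_sub_tendsto_zero.1 hf)
    -- Approximate the test function by `fs N` in `L^1`, uniformly in the sequence tested.
    obtain ⟨N, hN⟩ := ((tendsto_order.1 hf').2 (ε / 3) (by positivity)).exists
    have hN' : ∫ x, |f x - fs N x| ∂μ < ε / 3 := by
      rw [L1.norm_eq_integral_norm] at hN
      refine lt_of_eq_of_lt ?_ hN
      refine integral_congr_ae ?_
      filter_upwards [Lp.coeFn_sub (fs N) f] with x hx
      rw [hx, Pi.sub_apply, Real.norm_eq_abs, abs_sub_comm]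
    obtain ⟨M, hM⟩ := Metric.tendsto_atTop.1 (hfs N) (ε / 3) (by positivity)
    refine ⟨M, fun n hn => ?_⟩
    have h1 := abs_integral_mul_sub_le (L1.integrable_coeFn f) (L1.integrable_coeFn (fs N)) (hu n) (hub n)
    have h2 := abs_integral_mul_sub_le (L1.integrable_coeFn f) (L1.integrable_coeFn (fs N)) hv hvb
    have h3 := hM n hn
    rw [Real.dist_eq] at h3 ⊢
    rw [abs_le] at h1 h2
    rw [abs_lt] at h3 ⊢
    constructor <;> linarith [h1.1, h1.2, h2.1, h2.2, h3.1, h3.2]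
  · intro f g hfg _ hf
    have key : ∀ w : X → ℝ, ∫ x, f x * w x ∂μ = ∫ x, g x * w x ∂μ := fun w =>
      integral_congr_ae (hfg.mono fun x hx => by simp [hx])
    simpa only [key] using hf

/-- Sequential Banach–Alaoglu for `[0, 1]`-valued functions. The dual used is that of the Hilbert
space `L^2`; the limit is then clipped to take values in `[0, 1]` everywhere. -/
theorem exists_weakStarLim_subseq [MeasurableSpace.CountablyGenerated X] [IsFiniteMeasure μ]
    {u : ℕ → X → ℝ} (hu : ∀ n, AEMeasurable (u n) μ) (hub : ∀ n x, u n x ∈ Set.Icc (0 : ℝ) 1) :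
    ∃ k : ℕ → ℕ, StrictMono k ∧ ∃ v : X → ℝ, Measurable v ∧ (∀ x, v x ∈ Set.Icc (0 : ℝ) 1) ∧
      WeakStarLim μ (fun n => u (k n)) v := by
  have hb : ∀ n x, |u n x| ≤ 1 := fun n x => abs_le_one_of_mem_Icc (hub n x)
  have hL : ∀ n, MemLp (u n) 2 μ := fun n =>
    MemLp.of_bound (hu n).aestronglyMeasurable 1 (ae_of_all _ (hb n))
  let U : ℕ → Lp ℝ 2 μ := fun n => (hL n).toLp (u n)
  have : Fact ((2 : ENNReal) ≠ ⊤) := ⟨by simp⟩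
  let a : ℕ → WeakDual ℝ (Lp ℝ 2 μ) := fun n =>
    StrongDual.toWeakDual (InnerProductSpace.toDual ℝ (Lp ℝ 2 μ) (U n))
  obtain ⟨R, hR⟩ : ∃ R : ℝ, ∀ n, ‖U n‖ ≤ R := by
    refine ⟨_, fun n => Lp.norm_le_of_ae_bound (C := 1) zero_le_one ?_⟩
    filter_upwards [(hL n).coeFn_toLp] with x hx
    rw [hx]; exact hb n x
  obtain ⟨b, -, k, hk, hlim⟩ := WeakDual.isSeqCompact_closedBall ℝ (Lp ℝ 2 μ) 0 R (x := a)
    (fun n => by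
      simp only [Set.mem_preimage, mem_closedBall_zero_iff]
      exact (LinearIsometryEquiv.norm_map (InnerProductSpace.toDual ℝ (Lp ℝ 2 μ)) (U n)).trans_le (hR n))
  let V : Lp ℝ 2 μ := (InnerProductSpace.toDual ℝ (Lp ℝ 2 μ)).symm (WeakDual.toStrongDual b)
  have hVint : Integrable V μ := (Lp.memLp V).integrable (by norm_num)
  have hset : ∀ s, MeasurableSet s →
      Tendsto (fun n => ∫ x in s, u (k n) x ∂μ) atTop (𝓝 (∫ x in s, V x ∂μ)) := by
    intro s hs
    have h1 := (WeakBilin.tendsto_iff_forall_eval_tendsto _ ContinuousLinearMap.coe_injective).1 hlim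
      (indicatorConstLp 2 hs (measure_ne_top μ s) (1 : ℝ))
    have h2 : ∀ n, ∫ x in s, u (k n) x ∂μ
        = (a (k n)) (indicatorConstLp 2 hs (measure_ne_top μ s) (1 : ℝ)) := by
      intro n
      have : (a (k n)) (indicatorConstLp 2 hs (measure_ne_top μ s) (1 : ℝ))
        = inner ℝ (U (k n)) (indicatorConstLp 2 hs (measure_ne_top μ s) (1 : ℝ)) := rfl
      rw [this, real_inner_comm, L2.inner_indicatorConstLp_one]
      exact setIntegral_congr_ae hs ((hL (k n)).coeFn_toLp.mono fun x hx _ => hx.symm)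
    have h3 : ∫ x in s, V x ∂μ = b (indicatorConstLp 2 hs (measure_ne_top μ s) (1 : ℝ)) := by
      have : b (indicatorConstLp 2 hs (measure_ne_top μ s) (1 : ℝ))
        = inner ℝ V (indicatorConstLp 2 hs (measure_ne_top μ s) (1 : ℝ)) := by
        rw [InnerProductSpace.toDual_symm_apply]; rfl
      rw [this, real_inner_comm, L2.inner_indicatorConstLp_one]
    simp only [h2, h3]
    exact h1
  have hui : ∀ n, Integrable (u n) μ := fun n => integrable_of_abs_le_one (hu n) (hb n)
  have hV0 : (fun _ => (0 : ℝ)) ≤ᵐ[μ] V := by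
    refine ae_le_of_forall_setIntegral_le (integrable_const _) hVint fun s hs _ => ?_
    refine ge_of_tendsto' (hset s hs) fun n => ?_
    exact setIntegral_mono (integrable_const _).integrableOn (hui _).integrableOn fun x => (hub _ x).1
  have hV1 : V ≤ᵐ[μ] (fun _ => (1 : ℝ)) := by
    refine ae_le_of_forall_setIntegral_le hVint (integrable_const _) fun s hs _ => ?_
    refine le_of_tendsto' (hset s hs) fun n => ?_
    exact setIntegral_mono (hui _).integrableOn (integrable_const _).integrableOn fun x => (hub _ x).2
  have hVm := (Lp.stronglyMeasurable V).measurable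
  refine ⟨k, hk, fun x => max 0 (min 1 (V x)), by fun_prop, fun x => ⟨le_max_left _ _, ?_⟩, ?_⟩
  · exact max_le zero_le_one (min_le_left _ _)
  · have hve : (fun x => max 0 (min 1 (V x))) =ᵐ[μ] V := by
      filter_upwards [hV0, hV1] with x h0 h1
      rw [min_eq_right h1, max_eq_right h0]
    refine weakStarLim_of_setIntegral (fun n => hu _) (fun n => hb _) (by fun_prop) (fun x => ?_) ?_
    · exact abs_le_one_of_mem_Icc ⟨le_max_left _ _, max_le zero_le_one (min_le_left _ _)⟩
    · intro s hs _
      rw [setIntegral_congr_ae hs (hve.mono fun x hx _ => hx)]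
      exact hset s hs

theorem WeakStarLim.subseq {u : ℕ → X → ℝ} {v : X → ℝ} (h : WeakStarLim μ u v) {k : ℕ → ℕ}
    (hk : StrictMono k) : WeakStarLim μ (fun n => u (k n)) v :=
  fun g hg => (h g hg).comp hk.tendsto_atTop

theorem WeakStarLim.ae_unique [IsFiniteMeasure μ] {u : ℕ → X → ℝ} {v w : X → ℝ} (hv : Integrable v μ)
    (hw : Integrable w μ) (h : WeakStarLim μ u v) (h' : WeakStarLim μ u w) : v =ᵐ[μ] w := by
  refine ae_eq_of_forall_setIntegral_eq_of_sigmaFinite (fun _ _ _ => hv.integrableOn)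
    (fun _ _ _ => hw.integrableOn) fun s hs _ => ?_
  have key : ∀ z : X → ℝ, ∫ x, s.indicator (fun _ => (1 : ℝ)) x * z x ∂μ = ∫ x in s, z x ∂μ := by
    intro z
    rw [← integral_indicator hs]
    refine integral_congr_ae (ae_of_all _ fun x => ?_)
    by_cases hx : x ∈ s <;> simp [hx]
  have := tendsto_nhds_unique (h _ ((integrable_const (1 : ℝ)).indicator hs))
    (h' _ ((integrable_const (1 : ℝ)).indicator hs))
  rwa [key, key] at this

/-- Test functions that converge boundedly pointwise may be inserted in a weak* limit. -/
theorem WeakStarLim.tendsto_integral_mul [IsFiniteMeasure μ] {u : ℕ → X → ℝ} {v : X → ℝ}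
    (h : WeakStarLim μ u v) (hu : ∀ n, AEMeasurable (u n) μ) (hub : ∀ n x, |u n x| ≤ 1)
    {g : ℕ → X → ℝ} {g' : X → ℝ} {C : ℝ} (hg : ∀ n, AEMeasurable (g n) μ) (hg' : AEMeasurable g' μ)
    (hgb : ∀ n x, |g n x| ≤ C) (hgb' : ∀ x, |g' x| ≤ C)
    (hlim : ∀ᵐ x ∂μ, Tendsto (fun n => g n x) atTop (𝓝 (g' x))) :
    Tendsto (fun n => ∫ x, g n x * u n x ∂μ) atTop (𝓝 (∫ x, g' x * v x ∂μ)) := by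
  have hgi : ∀ n, Integrable (g n) μ := fun n =>
    Integrable.of_bound (hg n).aestronglyMeasurable C (ae_of_all _ (hgb n))
  have hgi' : Integrable g' μ :=
    Integrable.of_bound hg'.aestronglyMeasurable C (ae_of_all _ hgb')
  have h1 : Tendsto (fun n => ∫ x, |g n x - g' x| ∂μ) atTop (𝓝 0) := by
    have := tendsto_integral_of_dominated_convergence (μ := μ) (F := fun n x => |g n x - g' x|)
      (f := fun _ => (0 : ℝ)) (fun _ => C + C) (fun n => ((hgi n).sub hgi').abs.aestronglyMeasurable)
      (integrable_const _) (fun n => ae_of_all _ fun x => ?_) ?_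
    · simpa using this
    · rw [Real.norm_eq_abs, abs_abs]
      exact (abs_sub _ _).trans (add_le_add (hgb n x) (hgb' x))
    · filter_upwards [hlim] with x hx
      simpa using (hx.sub_const (g' x)).abs
  have h2 : Tendsto (fun n => ∫ x, g n x * u n x ∂μ - ∫ x, g' x * u n x ∂μ) atTop (𝓝 0) :=
    squeeze_zero_norm (fun n => abs_integral_mul_sub_le (hgi n) hgi' (hu n) (hub n)) h1
  simpa using h2.add (h g' hgi')

theorem WeakStarLim.ae_mono [IsFiniteMeasure μ] {u v : ℕ → X → ℝ} {u' v' : X → ℝ}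
    (hu : WeakStarLim μ u u') (hv : WeakStarLim μ v v') (hui : ∀ n, Integrable (u n) μ)
    (hvi : ∀ n, Integrable (v n) μ) (hui' : Integrable u' μ) (hvi' : Integrable v' μ)
    (h : ∀ n x, u n x ≤ v n x) : u' ≤ᵐ[μ] v' := by
  refine ae_le_of_forall_setIntegral_le hui' hvi' fun s hs _ => ?_
  have h1 := hu _ ((integrable_const (1 : ℝ)).indicator hs)
  have h2 := hv _ ((integrable_const (1 : ℝ)).indicator hs)
  simp only [← Set.indicator_mul_left, one_mul, integral_indicator hs] at h1 h2
  exact le_of_tendsto_of_tendsto' h1 h2 fun n =>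
    setIntegral_mono (hui n).integrableOn (hvi n).integrableOn (h n)

/-- The inner integrals over `y` converge by dominated convergence in `L^1` as functions of `x`, so that
they can serve as test functions for the outer integral. -/
theorem WeakStarLim.tensor [IsFiniteMeasure μ] {u : ℕ → X → ℝ} {v : X → ℝ}
    (h : WeakStarLim μ u v) (hu : ∀ n, Measurable (u n)) (hub : ∀ n x, |u n x| ≤ 1)
    (hv : Measurable v) (hvb : ∀ x, |v x| ≤ 1) :
    WeakStarLim (μ.prod μ) (fun n p => u n p.1 * u n p.2) (fun p => v p.1 * v p.2) := by
  intro g hg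
  have hint : ∀ w : X → ℝ, Measurable w → (∀ x, |w x| ≤ 1) →
      Integrable (fun p : X × X => g p * w p.2) (μ.prod μ) := fun w hw hb =>
    integrable_mul_of_abs_le_one hg (by fun_prop) fun p => hb p.2
  have hI : ∀ w : X → ℝ, Measurable w → (∀ x, |w x| ≤ 1) →
      Integrable (fun x => ∫ y, g (x, y) * w y ∂μ) μ := fun w hw hb =>
    (hint w hw hb).integral_prod_left
  have key : ∀ w : X → ℝ, Measurable w → (∀ x, |w x| ≤ 1) →
      ∫ p, g p * (w p.1 * w p.2) ∂(μ.prod μ) = ∫ x, (∫ y, g (x, y) * w y ∂μ) * w x ∂μ := by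
    intro w hw hb
    rw [integral_prod _ (integrable_mul_of_abs_le_one hg (by fun_prop) fun p => ?_)]
    · refine integral_congr_ae (ae_of_all _ fun x => ?_)
      simp only
      rw [← integral_mul_const]
      refine integral_congr_ae (ae_of_all _ fun y => ?_)
      simp only; ring
    · rw [abs_mul]; exact mul_le_one₀ (hb _) (abs_nonneg _) (hb _)
  rw [key v hv hvb]
  simp only [fun n => key (u n) (hu n) (hub n)]
  have h1 : Tendsto (fun n => ∫ x, |∫ y, g (x, y) * u n y ∂μ - ∫ y, g (x, y) * v y ∂μ| ∂μ)
      atTop (𝓝 0) := by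
    have := tendsto_integral_of_dominated_convergence (μ := μ)
      (F := fun n x => |∫ y, g (x, y) * u n y ∂μ - ∫ y, g (x, y) * v y ∂μ|)
      (f := fun _ => (0 : ℝ)) (fun x => 2 * ∫ y, |g (x, y)| ∂μ)
      (fun n => ((hI _ (hu n) (hub n)).sub (hI _ hv hvb)).abs.aestronglyMeasurable)
      (hg.abs.integral_prod_left.const_mul 2) (fun n => ?_) ?_
    · simpa using this
    · filter_upwards [hg.prod_right_ae] with x hx
      have hb : ∀ w : X → ℝ, Measurable w → (∀ x, |w x| ≤ 1) →
          |∫ y, g (x, y) * w y ∂μ| ≤ ∫ y, |g (x, y)| ∂μ := by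
        intro w hw hb
        refine abs_integral_le_integral_abs.trans (integral_mono_of_nonneg
          (ae_of_all _ fun _ => abs_nonneg _) hx.abs (ae_of_all _ fun y => ?_))
        simp only [abs_mul]
        exact mul_le_of_le_one_right (abs_nonneg _) (hb y)
      rw [Real.norm_eq_abs, abs_abs, two_mul]
      exact (abs_sub _ _).trans (add_le_add (hb _ (hu n) (hub n)) (hb _ hv hvb))
    · filter_upwards [hg.prod_right_ae] with x hx
      simpa using ((h _ hx).sub_const (∫ y, g (x, y) * v y ∂μ)).abs
  have h2 : Tendsto (fun n => ∫ x, (∫ y, g (x, y) * u n y ∂μ) * u n x ∂μ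
      - ∫ x, (∫ y, g (x, y) * v y ∂μ) * u n x ∂μ) atTop (𝓝 0) :=
    squeeze_zero_norm (fun n => abs_integral_mul_sub_le (hI _ (hu n) (hub n)) (hI _ hv hvb)
      (hu n).aemeasurable (hub n)) h1
  simpa using h2.add (h _ (hI _ hv hvb))

/-- A function continuous on `[0, 1]` composed with a measurable `[0, 1]`-valued function. -/
theorem integrable_comp_of_continuousOn [IsFiniteMeasure μ] {f : ℝ → ℝ}
    (hf : ContinuousOn f (Set.Icc 0 1)) {u : X → ℝ} (hu : AEMeasurable u μ)
    (hub : ∀ x, u x ∈ Set.Icc (0 : ℝ) 1) : Integrable (fun x => f (u x)) μ := by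
  obtain ⟨C, hC⟩ := isCompact_Icc.exists_bound_of_continuousOn hf
  refine Integrable.of_bound (C := C) ?_ (ae_of_all _ fun x => hC _ (hub x))
  have hc : Continuous (Set.IccExtend (zero_le_one' ℝ) ((Set.Icc (0 : ℝ) 1).domRestrict f)) :=
    hf.domRestrict.Icc_extend'
  have : (fun x => f (u x)) = fun x => Set.IccExtend (zero_le_one' ℝ) ((Set.Icc (0 : ℝ) 1).domRestrict f) (u x) := by
    funext x
    rw [Set.IccExtend_of_mem _ _ (hub x)]; rfl
  rw [this]
  exact (hc.measurable.comp_aemeasurable hu).aestronglyMeasurable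

theorem integral_eq_sum_setIntegral_fiber {ι : Type*} [Fintype ι] [MeasurableSpace ι]
    [MeasurableSingletonClass ι] {e : X → ι} (he : Measurable e) {g : X → ℝ} (hg : Integrable g μ) :
    ∫ x, g x ∂μ = ∑ i, ∫ x in e ⁻¹' {i}, g x ∂μ := by
  rw [← integral_iUnion_fintype (fun i => he (measurableSet_singleton i)) ?_ fun i => hg.integrableOn]
  · rw [← Set.preimage_iUnion, Set.iUnion_of_singleton, Set.preimage_univ, setIntegral_univ]
  · intro i j hij
    exact Disjoint.preimage _ (by simpa using hij)

/-- Weak* upper semicontinuity of `v ↦ ∫ f ∘ v` for concave `f`: on each piece of a finite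
partition on which the limit `v` is nearly constant, Jensen bounds `∫ f ∘ u n` by a continuous
function of the average of `u n` over the piece, and these averages converge. -/
theorem WeakStarLim.le_integral_concave [IsFiniteMeasure μ] {f : ℝ → ℝ}
    (hf : ContinuousOn f (Set.Icc 0 1)) (hfc : ConcaveOn ℝ (Set.Icc 0 1) f)
    {u : ℕ → X → ℝ} {v : X → ℝ} (h : WeakStarLim μ u v)
    (hu : ∀ n, AEMeasurable (u n) μ) (hub : ∀ n x, u n x ∈ Set.Icc (0 : ℝ) 1)
    (hv : AEMeasurable v μ) (hvb : ∀ x, v x ∈ Set.Icc (0 : ℝ) 1) {c : ℝ}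
    (hc : ∀ n, c ≤ ∫ x, f (u n x) ∂μ) : c ≤ ∫ x, f (v x) ∂μ := by
  wlog hvm : Measurable v generalizing v
  · let v' : X → ℝ := fun x => max 0 (min 1 (hv.mk v x))
    have hv'm : Measurable v' := by
      have := hv.measurable_mk
      fun_prop
    have hvv : v =ᵐ[μ] v' := by
      filter_upwards [hv.ae_eq_mk] with x hx
      simp only [v', ← hx, min_eq_right (hvb x).2, max_eq_right (hvb x).1]
    have := this (v := v') (fun g hg => ?_) hv'm.aemeasurable
      (fun x => ⟨le_max_left _ _, max_le zero_le_one (min_le_left _ _)⟩) hv'm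
    · rwa [integral_congr_ae (hvv.mono fun x hx => by simp only [hx] : ∀ᵐ x ∂μ, f (v x) = f (v' x))]
    · rw [← integral_congr_ae (hvv.mono fun x hx => by simp only [hx] : ∀ᵐ x ∂μ, g x * v x = g x * v' x)]
      exact h g hg
  refine le_of_forall_pos_le_add fun ε hε => ?_
  obtain ⟨δ, hδ, hfδ⟩ := Metric.uniformContinuousOn_iff.1
    (isCompact_Icc.uniformContinuousOn_of_continuous hf) (ε / (μ.real Set.univ + 1)) (by positivity)
  obtain ⟨N, hN⟩ := exists_nat_gt (1 / δ)
  have hN0 : (0 : ℝ) < N := lt_trans (by positivity) hN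
  have hNδ : 1 / (N : ℝ) < δ := by
    rw [div_lt_iff₀ hN0]; rw [div_lt_iff₀ hδ] at hN; linarith
  -- The pieces are the level sets of `⌊N * v⌋`, on which `v` varies by at most `1 / N`.
  let e : X → Fin (N + 1) := fun x => ⟨⌊N * v x⌋₊, by
    have : (N : ℝ) * v x ≤ N := mul_le_of_le_one_right hN0.le (hvb x).2
    exact Nat.lt_succ_of_le (Nat.floor_le_of_le this)⟩
  have he : Measurable e := by
    have : Measurable fun x => ⌊(N : ℝ) * v x⌋₊ := by fun_prop
    refine measurable_to_countable' fun i => ?_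
    convert this (measurableSet_singleton (i : ℕ)) using 1
    ext x
    simp [e, Fin.ext_iff]
  let E : Fin (N + 1) → Set X := fun i => e ⁻¹' {i}
  have hE : ∀ i, MeasurableSet (E i) := fun i => he (measurableSet_singleton i)
  have hclose : ∀ i, ∀ x ∈ E i, ∀ y ∈ E i, |v x - v y| ≤ 1 / N := by
    have key : ∀ i, ∀ x ∈ E i, (i : ℝ) ≤ N * v x ∧ N * v x < i + 1 := by
      rintro i x rfl
      exact ⟨Nat.floor_le (mul_nonneg hN0.le (hvb x).1), Nat.lt_floor_add_one _⟩
    intro i x hx y hy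
    have h1 := key i x hx
    have h2 := key i y hy
    rw [abs_sub_le_iff, le_div_iff₀ hN0, le_div_iff₀ hN0]
    constructor <;> nlinarith
  have hui : ∀ n, Integrable (u n) μ := fun n =>
    integrable_of_abs_le_one (hu n) fun x => abs_le_one_of_mem_Icc (hub n x)
  have hvi : Integrable v μ := integrable_of_abs_le_one hv fun x => abs_le_one_of_mem_Icc (hvb x)
  have avg_mem : ∀ w : X → ℝ, Integrable w μ → (∀ x, w x ∈ Set.Icc (0 : ℝ) 1) → ∀ i, μ (E i) ≠ 0 →
      (⨍ x in E i, w x ∂μ) ∈ Set.Icc (0 : ℝ) 1 := fun w hw hwb i hi =>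
    (convex_Icc (0 : ℝ) 1).set_average_mem isClosed_Icc hi (measure_ne_top _ _)
      (ae_of_all _ hwb) hw.integrableOn
  have step1 : ∀ n, c ≤ ∑ i, μ.real (E i) * f (⨍ x in E i, u n x ∂μ) := by
    intro n
    refine (hc n).trans ?_
    rw [integral_eq_sum_setIntegral_fiber he (integrable_comp_of_continuousOn hf (hu n) (hub n))]
    refine Finset.sum_le_sum fun i _ => ?_
    by_cases hi : μ (E i) = 0
    · rw [Measure.restrict_zero_set (show μ (e ⁻¹' {i}) = 0 from hi)]
      simp [measureReal_def, hi]
    · have := ConcaveOn.le_map_set_average hfc hf isClosed_Icc hi (measure_ne_top _ _) (ae_of_all _ (hub n))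
        (hui n).integrableOn (integrable_comp_of_continuousOn hf (hu n) (hub n)).integrableOn
      calc ∫ x in E i, f (u n x) ∂μ = μ.real (E i) * ⨍ x in E i, f (u n x) ∂μ := by
            rw [← smul_eq_mul, measure_smul_setAverage _ (measure_ne_top _ _)]
        _ ≤ _ := mul_le_mul_of_nonneg_left this measureReal_nonneg
  have step2 : Tendsto (fun n => ∑ i, μ.real (E i) * f (⨍ x in E i, u n x ∂μ)) atTop
      (𝓝 (∑ i, μ.real (E i) * f (⨍ x in E i, v x ∂μ))) := by
    refine tendsto_finsetSum _ fun i _ => ?_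
    by_cases hi : μ (E i) = 0
    · simp [measureReal_def, hi]
    refine Tendsto.const_mul _ ?_
    refine (hf _ (avg_mem v hvi hvb i hi)).tendsto.comp
      (tendsto_nhdsWithin_iff.2 ⟨?_, Eventually.of_forall fun n => avg_mem _ (hui n) (hub n) i hi⟩)
    simp only [setAverage_eq]
    refine Tendsto.const_smul ?_ _
    have := h _ ((integrable_const (1 : ℝ)).indicator (hE i))
    simpa only [← Set.indicator_mul_left, one_mul, integral_indicator (hE i)] using this
  refine (ge_of_tendsto' step2 step1).trans ?_
  have step3 : ∀ i, μ.real (E i) * f (⨍ x in E i, v x ∂μ)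
      ≤ ∫ x in E i, (f (v x) + ε / (μ.real Set.univ + 1)) ∂μ := by
    intro i
    by_cases hi : μ (E i) = 0
    · rw [Measure.restrict_zero_set hi]; simp [measureReal_def, hi]
    have hmem : ∀ x ∈ E i, |v x - ⨍ x in E i, v x ∂μ| < δ := by
      intro x hx
      have : (⨍ y in E i, v y ∂μ) ∈ Metric.closedBall (v x) (1 / N) := by
        refine (convex_closedBall (v x) (1 / N)).set_average_mem Metric.isClosed_closedBall hi
          (measure_ne_top _ _) ?_ hvi.integrableOn
        filter_upwards [ae_restrict_mem (hE i)] with y hy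
        rw [Metric.mem_closedBall, Real.dist_eq]
        exact hclose i y hy x hx
      rw [Metric.mem_closedBall, Real.dist_eq, abs_sub_comm] at this
      exact this.trans_lt hNδ
    rw [← smul_eq_mul, ← setIntegral_const]
    refine setIntegral_mono_on (integrable_const _).integrableOn
      ((integrable_comp_of_continuousOn hf hv hvb).add (integrable_const _)).integrableOn (hE i) ?_
    intro x hx
    have := hfδ _ (hvb x) _ (avg_mem v hvi hvb i hi) (hmem x hx)
    rw [Real.dist_eq, abs_lt] at this
    linarith [this.1]
  refine (Finset.sum_le_sum fun i _ => step3 i).trans ?_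
  have hsum : Integrable (fun x => f (v x) + ε / (μ.real Set.univ + 1)) μ :=
    (integrable_comp_of_continuousOn hf hv hvb).add (integrable_const _)
  rw [← integral_eq_sum_setIntegral_fiber he hsum, integral_add (integrable_comp_of_continuousOn hf hv hvb) (integrable_const _)]
  refine add_le_add_right ?_ _
  rw [integral_const, smul_eq_mul, mul_div_assoc', div_le_iff₀ (by positivity)]
  nlinarith [measureReal_nonneg (μ := μ) (s := Set.univ)]

end WeakStar

/-! ### Isomorphisms modulo null sets -/

section AEInverse

variable {α β : Type*} [MeasurableSpace α] [MeasurableSpace β]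

/-- By the Lusin–Souslin theorem, a measurable map that is injective on a measurable set has a
measurable left inverse on that set. -/
theorem exists_measurable_leftInvOn [StandardBorelSpace α] [StandardBorelSpace β] [Nonempty α]
    {T : α → β} (hT : Measurable T) {E : Set α} (hE : MeasurableSet E) (hinj : Set.InjOn T E) :
    ∃ S : β → α, Measurable S ∧ Set.LeftInvOn S T E := by
  have := hE.standardBorel
  have hemb : MeasurableEmbedding (E.domRestrict T) :=
    Measurable.measurableEmbedding (hT.comp measurable_subtype_coe) (Set.injOn_iff_injective.1 hinj)
  obtain ⟨S, hS, hST⟩ := hemb.exists_measurable_extend (g := ((↑) : E → α)) measurable_subtype_coe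
    (fun _ => inferInstance)
  exact ⟨S, hS, fun x hx => congrFun hST ⟨x, hx⟩⟩

/-- Measure-preserving maps that are inverse to each other almost everywhere. -/
structure AEInverse (T : α → β) (S : β → α) (μ : Measure α) (ν : Measure β) : Prop where
  fwd : MeasurePreserving T μ ν
  bwd : MeasurePreserving S ν μ
  left : ∀ᵐ x ∂μ, S (T x) = x
  right : ∀ᵐ y ∂ν, T (S y) = y

variable {μ : Measure α} {ν : Measure β} {T : α → β} {S : β → α}

theorem AEInverse.symm (h : AEInverse T S μ ν) : AEInverse S T ν μ := ⟨h.bwd, h.fwd, h.right, h.left⟩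

theorem AEInverse.trans {δ : Type*} [MeasurableSpace δ] {κ : Measure δ} {T' : β → δ} {S' : δ → β}
    (h : AEInverse T S μ ν) (h' : AEInverse T' S' ν κ) : AEInverse (T' ∘ T) (S ∘ S') μ κ := by
  refine ⟨h'.fwd.comp h.fwd, h.bwd.comp h'.bwd, ?_, ?_⟩
  · filter_upwards [h.left, h.fwd.quasiMeasurePreserving.ae h'.left] with x hx hx'
    simp [hx', hx]
  · filter_upwards [h'.right, h'.bwd.quasiMeasurePreserving.ae h.right] with x hx hx'
    simp [hx', hx]

/-- A one-sided inverse of a measure-preserving map is automatically measure-preserving and two-sided. -/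
theorem AEInverse.of_leftInverse [StandardBorelSpace β] (hT : MeasurePreserving T μ ν)
    (hS : Measurable S) (h : ∀ᵐ x ∂μ, S (T x) = x) : AEInverse T S μ ν := by
  refine ⟨hT, ⟨hS, ?_⟩, h, ?_⟩
  · rw [← hT.map_eq, Measure.map_map hS hT.measurable, Measure.map_congr (show S ∘ T =ᵐ[μ] id from h),
      Measure.map_id]
  · have hm : MeasurableSet {y | T (S y) = y} :=
      measurableSet_eq_fun (hT.measurable.comp hS) measurable_id
    rw [← hT.map_eq, ae_map_iff hT.measurable.aemeasurable hm]
    exact h.mono fun x hx => by simp [hx]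

theorem AEInverse.of_injOn [StandardBorelSpace α] [StandardBorelSpace β] [Nonempty α]
    (hT : MeasurePreserving T μ ν) {E : Set α} (hE : E ∈ ae μ) (hinj : Set.InjOn T E) :
    ∃ S, AEInverse T S μ ν := by
  obtain ⟨N, hN, hNm, hN0⟩ := exists_measurable_superset_of_null hE
  obtain ⟨S, hS, hST⟩ := exists_measurable_leftInvOn hT.measurable hNm.compl
    (hinj.mono (Set.compl_subset_comm.1 hN))
  exact ⟨S, .of_leftInverse hT hS (Filter.mem_of_superset (compl_mem_ae_iff.2 hN0) hST)⟩

theorem AEInverse.prodMap [SFinite μ] [SFinite ν] (h : AEInverse T S μ ν) :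
    AEInverse (Prod.map T T) (Prod.map S S) (μ.prod μ) (ν.prod ν) := by
  refine ⟨h.fwd.prod h.fwd, h.bwd.prod h.bwd, ?_, ?_⟩
  · filter_upwards [Measure.quasiMeasurePreserving_fst.ae h.left,
      Measure.quasiMeasurePreserving_snd.ae h.left] with p h1 h2
    exact Prod.ext h1 h2
  · filter_upwards [Measure.quasiMeasurePreserving_fst.ae h.right,
      Measure.quasiMeasurePreserving_snd.ae h.right] with p h1 h2
    exact Prod.ext h1 h2

/-- A map that is invertible almost everywhere for `μ` separates the measures dominated by `μ`. -/
theorem AEInverse.eq_of_map_eq (h : AEInverse T S μ ν) {m₁ m₂ : Measure α}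
    (h₁ : m₁ ≪ μ) (h₂ : m₂ ≪ μ) (heq : m₁.map T = m₂.map T) : m₁ = m₂ := by
  have key : ∀ m : Measure α, m ≪ μ → (m.map T).map S = m := by
    intro m hm
    rw [Measure.map_map h.bwd.measurable h.fwd.measurable,
      Measure.map_congr (show S ∘ T =ᵐ[m] id from hm.ae_le h.left), Measure.map_id]
  rw [← key m₁ h₁, heq, key m₂ h₂]

end AEInverse

/-! ### Sorting by a real key -/

section Cdf

open ProbabilityTheory

theorem continuous_cdf (μ : Measure ℝ) [IsProbabilityMeasure μ] [NullSingletonClass μ] :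
    Continuous (cdf μ) := by
  refine continuous_iff_continuousAt.2 fun x => ?_
  rw [(cdf μ).mono.continuousAt_iff_leftLim_eq_rightLim, StieltjesFunction.rightLim_eq]
  have h := (cdf μ).measure_singleton x
  rw [measure_cdf, measure_singleton, eq_comm, ENNReal.ofReal_eq_zero] at h
  exact le_antisymm ((cdf μ).mono.leftLim_le le_rfl) (by linarith)

/-- The cumulative distribution function as a map into the unit interval. -/
def unitCdf (μ : Measure ℝ) (t : ℝ) : unitInterval := ⟨cdf μ t, cdf_nonneg μ t, cdf_le_one μ t⟩

theorem measurable_unitCdf (μ : Measure ℝ) : Measurable (unitCdf μ) :=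
  (cdf μ).mono.measurable.subtype_mk

/-- The probability integral transform: an atomless distribution is carried to the uniform one by
its cumulative distribution function. -/
theorem measurePreserving_unitCdf (μ : Measure ℝ) [IsProbabilityMeasure μ] [NullSingletonClass μ] :
    MeasurePreserving (unitCdf μ) μ volume := by
  have hsurj : ∀ u : ℝ, 0 < u → u < 1 → ∃ s, cdf μ s = u := by
    intro u h0 h1
    exact mem_range_of_exists_le_of_exists_ge (continuous_cdf μ)
      (((tendsto_order.1 (tendsto_cdf_atBot μ)).2 u h0).exists.imp fun _ h => h.le)
      (((tendsto_order.1 (tendsto_cdf_atTop μ)).1 u h1).exists.imp fun _ h => h.le)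
  refine ⟨measurable_unitCdf μ, ?_⟩
  have : IsProbabilityMeasure (μ.map (unitCdf μ)) :=
    Measure.isProbabilityMeasure_map (measurable_unitCdf μ).aemeasurable
  refine Measure.ext_of_Iic _ _ fun u => ?_
  rw [Measure.map_apply (measurable_unitCdf μ) measurableSet_Iic, unitInterval.volume_Iic]
  have hpre : unitCdf μ ⁻¹' Set.Iic u = {t | cdf μ t ≤ u} := rfl
  rw [hpre]
  apply le_antisymm
  -- Upper bound: the level `u + ε` is attained at some `s`, and `{cdf ≤ u}` lies below `s`.
  · refine ENNReal.le_of_forall_pos_le_add fun ε hε _ => ?_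
    by_cases h1 : (u : ℝ) + ε < 1
    · obtain ⟨s, hs⟩ := hsurj (u + ε) (add_pos_of_nonneg_of_pos u.2.1 hε) h1
      calc μ {t | cdf μ t ≤ u} ≤ μ (Set.Iic s) := measure_mono fun t ht => by
            by_contra hts
            have := (cdf μ).mono (le_of_lt (not_le.1 hts))
            have h3 : cdf μ t ≤ u := ht
            have : (0 : ℝ) < ε := hε
            linarith
        _ = ENNReal.ofReal (u + ε) := by rw [← ofReal_cdf, hs]
        _ = _ := by rw [ENNReal.ofReal_add u.2.1 ε.coe_nonneg, ENNReal.ofReal_coe_nnreal]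
    · calc μ {t | cdf μ t ≤ u} ≤ 1 := prob_le_one
        _ ≤ ENNReal.ofReal (u + ε) := by rw [ENNReal.one_le_ofReal]; exact not_lt.1 h1
        _ = _ := by rw [ENNReal.ofReal_add u.2.1 ε.coe_nonneg, ENNReal.ofReal_coe_nnreal]
  · rcases eq_or_lt_of_le u.2.1 with h0 | h0
    · rw [← h0]; simp
    rcases eq_or_lt_of_le u.2.2 with h1 | h1
    · rw [h1]
      have : {t | cdf μ t ≤ 1} = Set.univ := Set.eq_univ_of_forall fun t => cdf_le_one μ t
      rw [this]; simp
    · obtain ⟨s, hs⟩ := hsurj u h0 h1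
      rw [← hs, ofReal_cdf]
      exact measure_mono fun t ht => (cdf μ).mono ht

/-- Only countably many level sets of the monotone cumulative distribution function are
nondegenerate, and each of them is a null set. -/
theorem exists_injOn_unitCdf (μ : Measure ℝ) [IsProbabilityMeasure μ] [NullSingletonClass μ] :
    ∃ E ∈ ae μ, Set.InjOn (unitCdf μ) E := by
  refine ⟨{t | ∀ q : ℚ, ¬ ((q : ℝ) < t ∧ unitCdf μ q = unitCdf μ t)}, ?_, ?_⟩
  · refine ae_all_iff.2 fun q => ?_
    have h : ∀ᵐ u : unitInterval, u ≠ unitCdf μ q := by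
      rw [ae_iff]; simp
    filter_upwards [(measurePreserving_unitCdf μ).quasiMeasurePreserving.ae h] with t ht h'
    exact ht h'.2.symm
  · have key : ∀ s t, s < t → (∀ q : ℚ, ¬ ((q : ℝ) < t ∧ unitCdf μ q = unitCdf μ t)) →
        unitCdf μ s ≠ unitCdf μ t := by
      intro s t hst ht h
      obtain ⟨q, hsq, hqt⟩ := exists_rat_btwn hst
      refine ht q ⟨hqt, le_antisymm ?_ ?_⟩
      · exact (cdf μ).mono hqt.le
      · rw [← h]; exact (cdf μ).mono hsq.le
    intro s hs t ht h
    rcases lt_trichotomy s t with hst | hst | hst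
    · exact absurd h (key s t hst ht)
    · exact hst
    · exact absurd h.symm (key t s hst hs)

/-- Sorting by a real-valued injective key: the rank `T p = m {q | h q ≤ h p}` is an isomorphism
modulo null sets from an atomless standard Borel probability space to the unit interval. -/
theorem exists_aeInverse_unitCdf {α : Type*} [MeasurableSpace α] [StandardBorelSpace α]
    (m : Measure α) [IsProbabilityMeasure m] [NullSingletonClass m] {h : α → ℝ} (hm : Measurable h)
    (hinj : Function.Injective h) :
    ∃ S, AEInverse (fun p => unitCdf (m.map h) (h p)) S m volume := by
  have : IsProbabilityMeasure (m.map h) := Measure.isProbabilityMeasure_map hm.aemeasurable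
  have : NullSingletonClass (m.map h) := ⟨fun x => by
    rw [Measure.map_apply hm (measurableSet_singleton x)]
    exact (Set.subsingleton_singleton.preimage hinj).measure_zero m⟩
  have : Nonempty α := nonempty_of_isProbabilityMeasure m
  obtain ⟨E, hE, hEinj⟩ := exists_injOn_unitCdf (m.map h)
  have hmp : MeasurePreserving h m (m.map h) := ⟨hm, rfl⟩
  exact AEInverse.of_injOn ((measurePreserving_unitCdf (m.map h)).comp hmp)
    (E := h ⁻¹' E) (hmp.quasiMeasurePreserving.ae hE)
    (fun x hx y hy hxy => hinj (hEinj hx hy hxy))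

end Cdf

/-! ### Integrability of graphons -/

namespace Graphon

theorem aemeasurable_sub (U V : Graphon) :
    AEMeasurable (fun p => U p - V p) (volume : Measure (unitInterval × unitInterval)) :=
  U.lebesgueMeasurable.sub V.lebesgueMeasurable

theorem abs_le_one (U : Graphon) (p : unitInterval × unitInterval) : |U p| ≤ 1 :=
  abs_le_one_of_mem_Icc (U.mem_Icc p)

theorem abs_sub_le_one (U V : Graphon) (p : unitInterval × unitInterval) : |U p - V p| ≤ 1 :=
  abs_le.2 ⟨by linarith [(U.mem_Icc p).1, (V.mem_Icc p).2], by linarith [(U.mem_Icc p).2, (V.mem_Icc p).1]⟩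

theorem integrable (U : Graphon) : Integrable U volume :=
  integrable_of_abs_le_one U.lebesgueMeasurable U.abs_le_one

theorem integrable_sub (U V : Graphon) : Integrable (fun p => U p - V p) volume :=
  U.integrable.sub V.integrable

/-! ### The cut norm

The supremum in `cutNorm` is the real one, so boundedness of the integrand is needed for it to be
meaningful. -/

theorem abs_setIntegral_le_one {D : unitInterval × unitInterval → ℝ} (hb : ∀ p, |D p| ≤ 1)
    (s : Set (unitInterval × unitInterval)) : |∫ p in s, D p| ≤ 1 := by
  have := norm_setIntegral_le_of_norm_le_const (μ := volume) (s := s) (f := D) (C := 1)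
    (measure_lt_top _ _) (fun x _ => hb x)
  rw [one_mul] at this
  exact this.trans measureReal_le_one

theorem le_cutNorm {D : unitInterval × unitInterval → ℝ} (hb : ∀ p, |D p| ≤ 1)
    {A : Set unitInterval} (hA : MeasurableSet A) : |∫ p in A ×ˢ A, D p| ≤ cutNorm D :=
  le_ciSup (f := fun A : {A : Set unitInterval // MeasurableSet A} =>
    |∫ p in (A : Set unitInterval) ×ˢ (A : Set unitInterval), D p|)
    ⟨1, by rintro _ ⟨A, rfl⟩; exact abs_setIntegral_le_one hb _⟩ ⟨A, hA⟩

theorem cutNorm_le {D : unitInterval × unitInterval → ℝ} {c : ℝ}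
    (h : ∀ A : Set unitInterval, MeasurableSet A → |∫ p in A ×ˢ A, D p| ≤ c) : cutNorm D ≤ c := by
  have : Nonempty {A : Set unitInterval // MeasurableSet A} := ⟨⟨∅, MeasurableSet.empty⟩⟩
  exact ciSup_le fun A => h A A.2

theorem exists_lt_of_lt_cutNorm {D : unitInterval × unitInterval → ℝ} {c : ℝ} (h : c < cutNorm D) :
    ∃ A : Set unitInterval, MeasurableSet A ∧ c < |∫ p in A ×ˢ A, D p| := by
  by_contra! hA
  exact absurd (cutNorm_le hA) (not_le.2 h)

theorem cutNorm_nonneg {D : unitInterval × unitInterval → ℝ} (hb : ∀ p, |D p| ≤ 1) : 0 ≤ cutNorm D :=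
  (abs_nonneg _).trans (le_cutNorm hb MeasurableSet.empty)

/-- The distance of two graphons in the cut norm, without passing to versions. -/
def cutDist (U V : Graphon) : ℝ := cutNorm fun p => U p - V p

theorem cutDist_nonneg (U V : Graphon) : 0 ≤ cutDist U V := cutNorm_nonneg (abs_sub_le_one U V)

theorem cutDist_comm (U V : Graphon) : cutDist U V = cutDist V U := by
  have : ∀ U V : Graphon, cutDist U V ≤ cutDist V U := fun U V => cutNorm_le fun A hA => by
    have := le_cutNorm (abs_sub_le_one V U) hA
    rw [integral_sub V.integrable.integrableOn U.integrable.integrableOn, abs_sub_comm] at this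
    rwa [integral_sub U.integrable.integrableOn V.integrable.integrableOn]
  exact le_antisymm (this U V) (this V U)

theorem cutDist_triangle (U V W : Graphon) : cutDist U W ≤ cutDist U V + cutDist V W :=
  cutNorm_le fun A hA => by
    refine le_trans (le_of_eq_of_le ?_ (abs_add_le _ _))
      (add_le_add (le_cutNorm (abs_sub_le_one U V) hA) (le_cutNorm (abs_sub_le_one V W) hA))
    rw [← integral_add (integrable_sub U V).integrableOn (integrable_sub V W).integrableOn]
    simp

theorem cutDist_self (U : Graphon) : cutDist U U = 0 :=
  le_antisymm (cutNorm_le fun A _ => by simp) (cutDist_nonneg U U)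

/-! ### Versions -/

theorem _root_.AEInverse.prodMap_fwd {γ δ : unitInterval → unitInterval} (h : AEInverse γ δ volume volume) :
    MeasurePreserving (Prod.map γ γ) (volume : Measure (unitInterval × unitInterval)) volume :=
  h.fwd.prod h.fwd

/-- The conull sets are those where the two compositions are the identity. -/
theorem isAlmostBijectionWithInverse_of_aeInverse {γ δ : unitInterval → unitInterval}
    (h : AEInverse γ δ volume volume) : IsAlmostBijectionWithInverse γ δ := by
  refine ⟨h.fwd, {x | δ (γ x) = x}, h.left, {y | γ (δ y) = y}, h.right, ⟨?_, ?_, ?_⟩, fun x hx => hx⟩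
  · intro x hx
    exact congrArg γ hx
  · exact Set.LeftInvOn.injOn (f₁' := δ) fun x hx => hx
  · intro y hy
    exact ⟨δ y, congrArg δ hy, hy⟩

/-- An almost-bijection has a measurable inverse, which agrees almost everywhere with any given one. -/
theorem IsAlmostBijectionWithInverse.exists_aeInverse {γ δ : unitInterval → unitInterval}
    (h : IsAlmostBijectionWithInverse γ δ) :
    ∃ δ', AEInverse γ δ' volume volume ∧ ∀ᵐ y, δ y = δ' y := by
  obtain ⟨hγ, J₁, hJ₁, J₂, -, -, hinv⟩ := h
  obtain ⟨S, hS⟩ := AEInverse.of_injOn hγ hJ₁ hinv.injOn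
  refine ⟨S, hS, ?_⟩
  filter_upwards [hS.right, hS.bwd.quasiMeasurePreserving.ae hJ₁] with y hy hy'
  have := hinv hy'
  rwa [hy] at this

/-- The relabelling `(x, y) ↦ W (δ x, δ y)` of a graphon by a measure-preserving map. -/
def pullback (W : Graphon) {δ : unitInterval → unitInterval} (hδ : MeasurePreserving δ volume volume) :
    Graphon where
  toFun p := W (δ p.1, δ p.2)
  lebesgueMeasurable := W.lebesgueMeasurable.comp_quasiMeasurePreserving
    (hδ.prod hδ).quasiMeasurePreserving
  symmetric _ _ := W.symmetric _ _
  mem_Icc _ := W.mem_Icc _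

/-- `Γ'` is the version of `Γ` obtained from `γ`, with measurable almost everywhere inverse `δ`. -/
def IsVersionVia (γ δ : unitInterval → unitInterval) (Γ' Γ : Graphon) : Prop :=
  AEInverse γ δ volume volume ∧ ∀ᵐ p : unitInterval × unitInterval, Γ' p = Γ (δ p.1, δ p.2)

theorem isVersion_iff {Γ' Γ : Graphon} : IsVersion Γ' Γ ↔ ∃ γ δ, IsVersionVia γ δ Γ' Γ := by
  constructor
  · rintro ⟨γ, δ, h, hΓ⟩
    obtain ⟨δ', h', hδ⟩ := h.exists_aeInverse
    refine ⟨γ, δ', h', ?_⟩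
    filter_upwards [hΓ, Measure.quasiMeasurePreserving_fst.ae hδ,
      Measure.quasiMeasurePreserving_snd.ae hδ] with p h1 h2 h3
    rw [h1, h2, h3]
  · rintro ⟨γ, δ, h, hΓ⟩
    exact ⟨γ, δ, isAlmostBijectionWithInverse_of_aeInverse h, hΓ⟩

theorem IsVersionVia.symm {γ δ : unitInterval → unitInterval} {Γ' Γ : Graphon}
    (h : IsVersionVia γ δ Γ' Γ) : IsVersionVia δ γ Γ Γ' := by
  refine ⟨h.1.symm, ?_⟩
  filter_upwards [h.1.prodMap_fwd.quasiMeasurePreserving.ae h.2,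
    Measure.quasiMeasurePreserving_fst.ae h.1.left,
    Measure.quasiMeasurePreserving_snd.ae h.1.left] with p h1 h2 h3
  simp only [Prod.map_fst, Prod.map_snd, h2, h3] at h1
  exact h1.symm

theorem IsVersionVia.trans {γ δ γ' δ' : unitInterval → unitInterval} {Γ'' Γ' Γ : Graphon}
    (h' : IsVersionVia γ' δ' Γ'' Γ') (h : IsVersionVia γ δ Γ' Γ) :
    IsVersionVia (γ' ∘ γ) (δ ∘ δ') Γ'' Γ := by
  refine ⟨h.1.trans h'.1, ?_⟩
  filter_upwards [h'.2, h'.1.symm.prodMap_fwd.quasiMeasurePreserving.ae h.2] with p h1 h2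
  exact h1.trans h2

theorem isVersionVia_pullback (W : Graphon) {γ δ : unitInterval → unitInterval}
    (h : AEInverse γ δ volume volume) : IsVersionVia γ δ (W.pullback h.bwd) W :=
  ⟨h, ae_of_all _ fun _ => rfl⟩

theorem isVersion_refl (W : Graphon) : IsVersion W W :=
  isVersion_iff.2 ⟨id, id, ⟨.id _, .id _, ae_of_all _ fun _ => rfl, ae_of_all _ fun _ => rfl⟩,
    ae_of_all _ fun _ => rfl⟩

theorem IsVersion.symm {U V : Graphon} (h : IsVersion U V) : IsVersion V U := by
  obtain ⟨γ, δ, h⟩ := isVersion_iff.1 h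
  exact isVersion_iff.2 ⟨δ, γ, h.symm⟩

theorem IsVersion.trans {U V W : Graphon} (h : IsVersion U V) (h' : IsVersion V W) : IsVersion U W := by
  obtain ⟨γ, δ, h⟩ := isVersion_iff.1 h
  obtain ⟨γ', δ', h'⟩ := isVersion_iff.1 h'
  exact isVersion_iff.2 ⟨_, _, h.trans h'⟩

/-- Relabelling two graphons simultaneously does not increase their distance in the cut norm. -/
theorem IsVersionVia.cutDist_le {γ δ : unitInterval → unitInterval} {U' U V' V : Graphon}
    (hU : IsVersionVia γ δ U' U) (hV : IsVersionVia γ δ V' V) : cutDist U' V' ≤ cutDist U V := by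
  refine cutNorm_le fun A hA => ?_
  have hγ := hU.1.fwd.measurable
  refine le_of_eq_of_le ?_ (le_cutNorm (abs_sub_le_one U V) (hγ hA))
  have hpre : (γ ⁻¹' A) ×ˢ (γ ⁻¹' A) = Prod.map γ γ ⁻¹' (A ×ˢ A) := rfl
  have hm := hU.1.prodMap_fwd
  rw [hpre, ← integral_indicator (hA.prod hA), ← integral_indicator (hm.measurable (hA.prod hA))]
  conv_lhs => rw [← hm.map_eq]
  rw [integral_map hm.measurable.aemeasurable (by
    rw [hm.map_eq]; exact ((aemeasurable_sub U' V').indicator (hA.prod hA)).aestronglyMeasurable)]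
  congr 1
  refine integral_congr_ae ?_
  filter_upwards [hU.symm.2, hV.symm.2] with p h1 h2
  rw [← Set.indicator_comp_right]
  simp only [Set.indicator, Function.comp_apply, h1, h2, Prod.map]

theorem IsVersionVia.INT_eq {γ δ : unitInterval → unitInterval} {U' U : Graphon}
    (h : IsVersionVia γ δ U' U) {f : ℝ → ℝ} (hf : ContinuousOn f (Set.Icc 0 1)) :
    INT f U' = INT f U := by
  have hm := h.1.symm.prodMap_fwd
  rw [INT, INT, integral_congr_ae (h.2.mono fun p hp => congrArg f hp)]
  conv_rhs => rw [← hm.map_eq]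
  rw [integral_map hm.measurable.aemeasurable (by
    rw [hm.map_eq]
    exact (integrable_comp_of_continuousOn hf U.lebesgueMeasurable U.mem_Icc).aestronglyMeasurable)]
  rfl

/-- Some version of `U` lies within `ε` of `V` in the cut norm. -/
def CutNear (ε : ℝ) (U V : Graphon) : Prop := ∃ U', IsVersion U' U ∧ cutDist U' V ≤ ε

/-- Nearness does not depend on the version of the second graphon: relabel the approximating version
of the first one in the same way. -/
theorem CutNear.version_right {ε : ℝ} {U V V' : Graphon} (h : CutNear ε U V) (hV : IsVersion V' V) :
    CutNear ε U V' := by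
  obtain ⟨U', hU', hd⟩ := h
  obtain ⟨γ, δ, hV⟩ := isVersion_iff.1 hV
  have := isVersionVia_pullback U' hV.1
  exact ⟨_, (isVersion_iff.2 ⟨_, _, this⟩).trans hU', (this.cutDist_le hV).trans hd⟩

theorem CutNear.symm {ε : ℝ} {U V : Graphon} (h : CutNear ε U V) : CutNear ε V U := by
  obtain ⟨U', hU', hd⟩ := h
  refine CutNear.version_right ⟨V, isVersion_refl V, ?_⟩ hU'.symm
  rwa [cutDist_comm]

theorem CutNear.trans {ε ε' : ℝ} {U V W : Graphon} (h : CutNear ε U V) (h' : CutNear ε' V W) :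
    CutNear (ε + ε') U W := by
  obtain ⟨V', hV', hd'⟩ := h'
  obtain ⟨U', hU', hd⟩ := h.version_right hV'
  exact ⟨U', hU', (cutDist_triangle _ V' _).trans (add_le_add hd hd')⟩

/-! ### Weak* convergence of graphons -/

/-- Weak* compactness of the space of graphons. The limit function is symmetric only almost everywhere,
and is replaced by its symmetrisation. -/
theorem exists_weakStarTendsto_subseq (Γ : ℕ → Graphon) :
    ∃ k : ℕ → ℕ, StrictMono k ∧ ∃ W : Graphon, Measurable W ∧ WeakStarTendsto (fun n => Γ (k n)) W := by
  obtain ⟨k, hk, v, hv, hvb, hlim⟩ := exists_weakStarLim_subseq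
    (μ := (volume : Measure (unitInterval × unitInterval)))
    (fun n => (Γ n).lebesgueMeasurable) fun n => (Γ n).mem_Icc
  refine ⟨k, hk, ⟨fun p : unitInterval × unitInterval => (v p + v p.swap) / 2, by fun_prop,
    fun x y => ?_, fun p => ?_⟩, ?_, ?_⟩
  · simp [add_comm]
  · have h1 := hvb p
    have h2 := hvb p.swap
    exact ⟨by linarith [h1.1, h2.1], by linarith [h1.2, h2.2]⟩
  · change Measurable fun p : unitInterval × unitInterval => (v p + v p.swap) / 2
    fun_prop
  · have hsw : MeasurePreserving (Prod.swap : unitInterval × unitInterval → _) volume volume :=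
      Measure.measurePreserving_swap
    have hlim' : WeakStarLim volume (fun n => Γ (k n)) (fun p : unitInterval × unitInterval => v p.swap) := by
      intro g hg
      have h1 := hlim _ (hsw.integrable_comp_of_integrable hg)
      have key : ∀ w : unitInterval × unitInterval → ℝ,
          ∫ p, g p * w p = ∫ p, g (Prod.swap p) * w (Prod.swap p) := fun w =>
        (hsw.integral_comp MeasurableEquiv.prodComm.measurableEmbedding (fun p => g p * w p)).symm
      rw [key]
      simp only [Prod.swap_swap, key (Γ (k _))]
      refine h1.congr fun n => integral_congr_ae (ae_of_all _ fun p => ?_)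
      simp only [Function.comp_apply]
      rw [show p.swap = (p.2, p.1) from rfl, (Γ (k n)).symmetric]
    have hae := hlim.ae_unique (integrable_of_abs_le_one hv.aemeasurable fun p => abs_le_one_of_mem_Icc (hvb p))
      (integrable_of_abs_le_one (by fun_prop) fun p => abs_le_one_of_mem_Icc (hvb p.swap)) hlim'
    intro g hg
    have : ∫ p, g p * ((v p + v p.swap) / 2) = ∫ p, g p * v p := by
      refine integral_congr_ae ?_
      filter_upwards [hae] with p hp
      rw [← hp]; ring
    change Tendsto _ _ (𝓝 (∫ p, g p * ((v p + v p.swap) / 2)))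
    rw [this]
    exact hlim g hg

theorem WeakStarTendsto.tendsto_setIntegral {Γ : ℕ → Graphon} {W : Graphon} (h : WeakStarTendsto Γ W)
    {s : Set (unitInterval × unitInterval)} (hs : MeasurableSet s) :
    Tendsto (fun n => ∫ p in s, Γ n p) atTop (𝓝 (∫ p in s, W p)) := by
  have := h _ ((integrable_const (1 : ℝ)).indicator hs)
  simpa only [← Set.indicator_mul_left, one_mul, integral_indicator hs] using this

theorem WeakStarTendsto.subseq {Γ : ℕ → Graphon} {W : Graphon} (h : WeakStarTendsto Γ W) {k : ℕ → ℕ}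
    (hk : StrictMono k) : WeakStarTendsto (fun n => Γ (k n)) W :=
  WeakStarLim.subseq (u := fun n => Γ n) h hk

/-- The cut distance is weak* lower semicontinuous. -/
theorem WeakStarTendsto.cutDist_le {Γ Δ : ℕ → Graphon} {U V : Graphon} {c : ℝ} (hU : WeakStarTendsto Γ U)
    (hV : WeakStarTendsto Δ V) (hc : ∀ᶠ n in atTop, cutDist (Γ n) (Δ n) ≤ c) : cutDist U V ≤ c := by
  refine cutNorm_le fun A hA => ?_
  rw [integral_sub U.integrable.integrableOn V.integrable.integrableOn]
  refine le_of_tendsto ((hU.tendsto_setIntegral (hA.prod hA)).sub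
    (hV.tendsto_setIntegral (hA.prod hA))).abs (hc.mono fun n hn => ?_)
  rw [← integral_sub (Γ n).integrable.integrableOn (Δ n).integrable.integrableOn]
  exact (le_cutNorm (abs_sub_le_one _ _) hA).trans hn

theorem weakStarTendsto_const (U : Graphon) : WeakStarTendsto (fun _ => U) U :=
  fun _ _ => tendsto_const_nhds

/-- The cut norm separates graphons: by symmetry, the integrals over the squares `A × A` determine
those over rectangles. -/
theorem ae_eq_of_cutDist_le_zero {U V : Graphon} (h : cutDist U V ≤ 0) :
    (U : unitInterval × unitInterval → ℝ) =ᵐ[volume] V := by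
  let D : unitInterval × unitInterval → ℝ := fun p => U p - V p
  have hDi : Integrable D volume := integrable_sub U V
  have hsq : ∀ A : Set unitInterval, MeasurableSet A → ∫ p in A ×ˢ A, D p = 0 := fun A hA =>
    abs_eq_zero.1 (le_antisymm ((le_cutNorm (abs_sub_le_one U V) hA).trans h) (abs_nonneg _))
  have hswap : ∀ A B : Set unitInterval, ∫ p in A ×ˢ B, D p = ∫ p in B ×ˢ A, D p := by
    intro A B
    have hsw : MeasurePreserving (Prod.swap : unitInterval × unitInterval → _) volume volume :=
      Measure.measurePreserving_swap
    have := hsw.setIntegral_preimage_emb MeasurableEquiv.prodComm.measurableEmbedding D (B ×ˢ A)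
    rw [Set.preimage_swap_prod] at this
    rw [← this]
    refine integral_congr_ae (ae_of_all _ fun p => ?_)
    simp only [D, Prod.swap, U.symmetric p.2, V.symmetric p.2]
  have hunion : ∀ A A' B : Set unitInterval, MeasurableSet A' → MeasurableSet B → Disjoint A A' →
      ∫ p in (A ∪ A') ×ˢ B, D p = (∫ p in A ×ˢ B, D p) + ∫ p in A' ×ˢ B, D p := by
    intro A A' B hA' hB hd
    rw [Set.union_prod]
    exact setIntegral_union (Set.disjoint_prod.2 (Or.inl hd)) (hA'.prod hB) hDi.integrableOn hDi.integrableOn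
  have hdisj : ∀ A B : Set unitInterval, MeasurableSet A → MeasurableSet B → Disjoint A B →
      ∫ p in A ×ˢ B, D p = 0 := by
    intro A B hA hB hd
    have h1 := hsq _ (hA.union hB)
    rw [hunion A B _ hB (hA.union hB) hd, hswap A, hswap B, hunion A B A hB hA hd,
      hunion A B B hB hB hd, hsq A hA, hsq B hB, hswap B A] at h1
    linarith
  have hrect : ∀ A B : Set unitInterval, MeasurableSet A → MeasurableSet B → ∫ p in A ×ˢ B, D p = 0 := by
    intro A B hA hB
    have h1 := hunion (A \ B) (A ∩ B) B (hA.inter hB) hB (Set.disjoint_sdiff_inter)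
    have h2 := hunion (B \ A) (B ∩ A) (A ∩ B) (hB.inter hA) (hA.inter hB) (Set.disjoint_sdiff_inter)
    rw [Set.sdiff_union_inter] at h1 h2
    rw [h1, hdisj _ _ (hA.diff hB) hB Set.disjoint_sdiff_left, hswap, h2,
      hdisj _ _ (hB.diff hA) (hA.inter hB)
        (Set.disjoint_sdiff_left.mono_right Set.inter_subset_left), Set.inter_comm B A,
      hsq _ (hA.inter hB)]
    simp
  have hdens : ∀ W : Graphon, ∀ s : Set (unitInterval × unitInterval), MeasurableSet s →
      (volume.withDensity fun p => ENNReal.ofReal (W p)) s = ENNReal.ofReal (∫ p in s, W p) := by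
    intro W s hs
    rw [withDensity_apply _ hs, ofReal_integral_eq_lintegral_ofReal W.integrable.integrableOn
      (ae_of_all _ fun p => (W.mem_Icc p).1)]
  have hfin : ∀ W : Graphon, IsFiniteMeasure
      ((volume : Measure (unitInterval × unitInterval)).withDensity fun p => ENNReal.ofReal (W p)) :=
    fun W => ⟨by rw [hdens W _ MeasurableSet.univ]; exact ENNReal.ofReal_lt_top⟩
  have := hfin U
  have heq : ((volume : Measure (unitInterval × unitInterval)).withDensity fun p => ENNReal.ofReal (U p))
      = volume.withDensity fun p => ENNReal.ofReal (V p) := by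
    refine Measure.ext_prod fun {A B} hA hB => ?_
    rw [hdens U _ (hA.prod hB), hdens V _ (hA.prod hB)]
    have := hrect A B hA hB
    simp only [D] at this
    rw [integral_sub U.integrable.integrableOn V.integrable.integrableOn, sub_eq_zero] at this
    rw [this]
  rw [withDensity_eq_iff_of_sigmaFinite U.lebesgueMeasurable.ennreal_ofReal
    V.lebesgueMeasurable.ennreal_ofReal] at heq
  filter_upwards [heq] with p hp
  exact (ENNReal.ofReal_eq_ofReal_iff (U.mem_Icc p).1 (V.mem_Icc p).1).1 hp

end Graphon

/-! ### The doubled interval -/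

/-- The measure on two disjoint copies of the unit interval which is Lebesgue measure on each copy. -/
def doubleVolume : Measure (Bool × unitInterval) :=
  (volume : Measure unitInterval).map (Prod.mk true) + (volume : Measure unitInterval).map (Prod.mk false)

instance : IsFiniteMeasure doubleVolume := by
  unfold doubleVolume
  infer_instance

/-- The four embeddings of the square into the square of the doubled interval. -/
def sheet (c : Bool × Bool) (z : unitInterval × unitInterval) :
    (Bool × unitInterval) × (Bool × unitInterval) := ((c.1, z.1), (c.2, z.2))

/-- The projection from the square of the doubled interval to the square. -/
def unsheet (p : (Bool × unitInterval) × (Bool × unitInterval)) : unitInterval × unitInterval :=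
  (p.1.2, p.2.2)

@[fun_prop]
theorem measurable_sheet (c : Bool × Bool) : Measurable (sheet c) := by
  unfold sheet; fun_prop

@[fun_prop]
theorem measurable_unsheet : Measurable unsheet := by
  unfold unsheet; fun_prop

@[simp] theorem unsheet_sheet (c : Bool × Bool) (z : unitInterval × unitInterval) :
    unsheet (sheet c z) = z := rfl

theorem doubleVolume_prod :
    doubleVolume.prod doubleVolume = ∑ c, (volume : Measure (unitInterval × unitInterval)).map (sheet c) := by
  have key : ∀ a b : Bool, ((volume : Measure unitInterval).map (Prod.mk a)).prod
      ((volume : Measure unitInterval).map (Prod.mk b)) = volume.map (sheet (a, b)) := fun a b =>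
    Measure.map_prod_map _ _ measurable_prodMk_left measurable_prodMk_left
  rw [doubleVolume, Measure.add_prod, Measure.prod_add, Measure.prod_add, key, key, key, key]
  simp only [Fintype.sum_prod_type, Fintype.sum_bool]

theorem map_sheet_le (c : Bool × Bool) :
    (volume : Measure (unitInterval × unitInterval)).map (sheet c) ≤ doubleVolume.prod doubleVolume := by
  rw [doubleVolume_prod]
  exact Finset.single_le_sum (f := fun c => (volume : Measure (unitInterval × unitInterval)).map (sheet c))
    (fun _ _ => Measure.zero_le _) (Finset.mem_univ c)

theorem quasiMeasurePreserving_sheet (c : Bool × Bool) :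
    Measure.QuasiMeasurePreserving (sheet c) volume (doubleVolume.prod doubleVolume) :=
  ⟨measurable_sheet c, (map_sheet_le c).absolutelyContinuous⟩

theorem quasiMeasurePreserving_unsheet :
    Measure.QuasiMeasurePreserving unsheet (doubleVolume.prod doubleVolume) volume := by
  refine ⟨measurable_unsheet, ?_⟩
  intro s hs
  rw [doubleVolume_prod, Measure.map_finset_sum measurable_unsheet.aemeasurable, Measure.finsetSum_apply]
  refine Finset.sum_eq_zero fun c _ => ?_
  rw [Measure.map_map measurable_unsheet (measurable_sheet c),
    show unsheet ∘ sheet c = id from funext fun z => unsheet_sheet c z, Measure.map_id]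
  exact hs

theorem integral_doubleVolume_prod {F : (Bool × unitInterval) × (Bool × unitInterval) → ℝ}
    (hF : Integrable F (doubleVolume.prod doubleVolume)) :
    ∫ p, F p ∂(doubleVolume.prod doubleVolume) = ∑ c, ∫ z, F (sheet c z) := by
  have hc : ∀ c, Integrable F ((volume : Measure (unitInterval × unitInterval)).map (sheet c)) := fun c =>
    hF.mono_measure (map_sheet_le c)
  rw [doubleVolume_prod, integral_finsetSum_measure fun c _ => hc c]
  exact Finset.sum_congr rfl fun c _ => integral_map (measurable_sheet c).aemeasurable (hc c).1

theorem MeasureTheory.Integrable.comp_sheet {F : (Bool × unitInterval) × (Bool × unitInterval) → ℝ}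
    (hF : Integrable F (doubleVolume.prod doubleVolume)) (c : Bool × Bool) :
    Integrable (fun z => F (sheet c z)) volume :=
  (hF.mono_measure (map_sheet_le c)).comp_measurable (measurable_sheet c)

theorem MeasureTheory.Integrable.comp_unsheet {g : unitInterval × unitInterval → ℝ} (hg : Integrable g volume) :
    Integrable (fun p => g (unsheet p)) (doubleVolume.prod doubleVolume) := by
  rw [doubleVolume_prod, integrable_finsetSum_measure]
  intro c _
  rw [integrable_map_measure _ (measurable_sheet c).aemeasurable]
  · exact hg
  · exact (hg.aestronglyMeasurable.comp_quasiMeasurePreserving quasiMeasurePreserving_unsheet).mono_measure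
      (map_sheet_le c)

/-- Summing a weak* convergent sequence over the four sheets gives a weak* convergent sequence. -/
theorem WeakStarLim.sum_sheet {K : ℕ → (Bool × unitInterval) × (Bool × unitInterval) → ℝ}
    {K' : (Bool × unitInterval) × (Bool × unitInterval) → ℝ}
    (h : WeakStarLim (doubleVolume.prod doubleVolume) K K')
    (hK : ∀ n, AEMeasurable (K n) (doubleVolume.prod doubleVolume)) (hKb : ∀ n p, |K n p| ≤ 1)
    (hK' : AEMeasurable K' (doubleVolume.prod doubleVolume)) (hKb' : ∀ p, |K' p| ≤ 1) :
    WeakStarLim volume (fun n z => ∑ c, K n (sheet c z)) (fun z => ∑ c, K' (sheet c z)) := by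
  intro g hg
  have key : ∀ w : (Bool × unitInterval) × (Bool × unitInterval) → ℝ,
      AEMeasurable w (doubleVolume.prod doubleVolume) → (∀ p, |w p| ≤ 1) →
      ∫ z, g z * ∑ c, w (sheet c z) = ∫ p, g (unsheet p) * w p ∂(doubleVolume.prod doubleVolume) := by
    intro w hw hb
    have hi := integrable_mul_of_abs_le_one hg.comp_unsheet hw hb
    rw [integral_doubleVolume_prod hi, ← integral_finsetSum _ fun c _ => hi.comp_sheet c]
    refine integral_congr_ae (ae_of_all _ fun z => ?_)
    simp only [unsheet_sheet, Finset.mul_sum]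
  rw [key K' hK' hKb']
  simp only [fun n => key (K n) (hK n) (hKb n)]
  exact h _ hg.comp_unsheet

open Classical in
/-- The indicator, on the doubled interval, of the copy of `A` in the first interval together with
the copy of the complement of `A` in the second one. -/
def side (A : Set unitInterval) (p : Bool × unitInterval) : ℝ := if p.1 = decide (p.2 ∈ A) then 1 else 0

open Classical in
/-- The graph of the indicator of `A`. -/
def sideGraph (A : Set unitInterval) (x : unitInterval) : Bool × unitInterval := (decide (x ∈ A), x)

theorem measurable_decide_mem {A : Set unitInterval} (hA : MeasurableSet A) [DecidablePred (· ∈ A)] :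
    Measurable fun x => decide (x ∈ A) := by
  refine measurable_to_bool ?_
  convert hA using 1
  ext x; simp

open Classical in
theorem measurable_sideGraph {A : Set unitInterval} (hA : MeasurableSet A) : Measurable (sideGraph A) :=
  (measurable_decide_mem hA).prodMk measurable_id

open Classical in
theorem measurable_side {A : Set unitInterval} (hA : MeasurableSet A) : Measurable (side A) :=
  Measurable.ite (measurableSet_eq_fun measurable_fst ((measurable_decide_mem hA).comp measurable_snd))
    measurable_const measurable_const

theorem side_mem_Icc (A : Set unitInterval) (p : Bool × unitInterval) : side A p ∈ Set.Icc (0 : ℝ) 1 := by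
  unfold side; split_ifs <;> simp

/-- The measure with density `ψ` on the doubled interval. -/
def sideMeasure (ψ : Bool × unitInterval → ℝ) : Measure (Bool × unitInterval) :=
  doubleVolume.withDensity fun p => ENNReal.ofReal (ψ p)

/-- Pushing Lebesgue measure to the graph of the indicator of `A` gives the measure with density
`side A`. -/
theorem map_sideGraph {A : Set unitInterval} (hA : MeasurableSet A) :
    (volume : Measure unitInterval).map (sideGraph A) = sideMeasure (side A) := by
  refine Measure.ext_of_lintegral _ fun φ hφ => ?_
  have hs := (measurable_side hA).ennreal_ofReal
  have hm : Measurable fun p => ENNReal.ofReal (side A p) * φ p := hs.mul hφ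
  rw [lintegral_map hφ (measurable_sideGraph hA), sideMeasure, lintegral_withDensity_eq_lintegral_mul _ hs hφ,
    doubleVolume, lintegral_add_measure, lintegral_map (hs.mul hφ) measurable_prodMk_left,
    lintegral_map (hs.mul hφ) measurable_prodMk_left, ← lintegral_add_left]
  · refine lintegral_congr fun x => ?_
    by_cases hx : x ∈ A <;> simp [side, sideGraph, hx]
  · exact hm.comp measurable_prodMk_left

theorem integral_sideMeasure_prod {ψ : Bool × unitInterval → ℝ} (hψ : Measurable ψ) (h0 : ∀ p, 0 ≤ ψ p)
    (F : (Bool × unitInterval) × (Bool × unitInterval) → ℝ) :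
    ∫ p, F p ∂((sideMeasure ψ).prod (sideMeasure ψ))
      = ∫ p, ψ p.1 * ψ p.2 * F p ∂(doubleVolume.prod doubleVolume) := by
  rw [sideMeasure, prod_withDensity hψ.ennreal_ofReal hψ.ennreal_ofReal,
    integral_withDensity_eq_integral_toReal_smul (by fun_prop)
      (ae_of_all _ fun p => ENNReal.mul_lt_top ENNReal.ofReal_lt_top ENNReal.ofReal_lt_top)]
  refine integral_congr_ae (ae_of_all _ fun p => ?_)
  simp [ENNReal.toReal_ofReal (h0 _)]

theorem sideMeasure_real_apply {ψ : Bool × unitInterval → ℝ} (hψ : Measurable ψ)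
    (hb : ∀ p, ψ p ∈ Set.Icc (0 : ℝ) 1) {s : Set (Bool × unitInterval)} (hs : MeasurableSet s) :
    (sideMeasure ψ).real s = ∫ p, s.indicator (fun _ => (1 : ℝ)) p * ψ p ∂doubleVolume := by
  have hi : Integrable ψ doubleVolume :=
    integrable_of_abs_le_one hψ.aemeasurable fun p => abs_le_one_of_mem_Icc (hb p)
  rw [measureReal_def, sideMeasure, withDensity_apply _ hs,
    ← ofReal_integral_eq_lintegral_ofReal hi.integrableOn (ae_of_all _ fun p => (hb p).1),
    ENNReal.toReal_ofReal (integral_nonneg fun p => (hb p).1), ← integral_indicator hs]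
  simp only [← Set.indicator_mul_left, one_mul]

theorem isFiniteMeasure_sideMeasure {ψ : Bool × unitInterval → ℝ} (hψ : Measurable ψ)
    (hb : ∀ p, ψ p ∈ Set.Icc (0 : ℝ) 1) : IsFiniteMeasure (sideMeasure ψ) :=
  isFiniteMeasure_withDensity_ofReal
    (integrable_of_abs_le_one hψ.aemeasurable fun p => abs_le_one_of_mem_Icc (hb p)).2

instance : NullSingletonClass doubleVolume := ⟨fun p => by
  rw [doubleVolume, Measure.add_apply, Measure.map_apply measurable_prodMk_left (measurableSet_singleton _),
    Measure.map_apply measurable_prodMk_left (measurableSet_singleton _)]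
  simp only [add_eq_zero]
  constructor <;>
  exact (Set.subsingleton_singleton.preimage (Prod.mk_right_injective _)).measure_zero _⟩

instance (ψ : Bool × unitInterval → ℝ) : NullSingletonClass (sideMeasure ψ) :=
  ⟨fun p => withDensity_absolutelyContinuous _ _ (measure_singleton p)⟩

/-- The sorting key: the copy indexed by `true` precedes the other one, and each keeps its order. -/
def sortKey (p : Bool × unitInterval) : ℝ := p.2 - if p.1 then 2 else 0

@[fun_prop]
theorem measurable_sortKey : Measurable sortKey := by
  unfold sortKey
  refine Measurable.sub (by fun_prop) ?_
  exact (measurable_of_countable (fun b : Bool => if b then (2 : ℝ) else 0)).comp measurable_fst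

theorem sortKey_injective : Function.Injective sortKey := by
  rintro ⟨a, x, hx0, hx1⟩ ⟨b, y, hy0, hy1⟩ h
  cases a <;> cases b <;> simp [sortKey] at h ⊢ <;>
    first | exact Subtype.ext h | (exfalso; linarith)

/-- The rank of a point of the doubled interval with respect to `sideMeasure ψ` in the order of
`sortKey`. -/
def rank (ψ : Bool × unitInterval → ℝ) (p : Bool × unitInterval) : unitInterval :=
  unitCdf ((sideMeasure ψ).map sortKey) (sortKey p)

theorem rank_coe {ψ : Bool × unitInterval → ℝ} [IsProbabilityMeasure (sideMeasure ψ)] (hψ : Measurable ψ)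
    (hb : ∀ p, ψ p ∈ Set.Icc (0 : ℝ) 1) (p : Bool × unitInterval) :
    (rank ψ p : ℝ) = ∫ q, {q | sortKey q ≤ sortKey p}.indicator (fun _ => (1 : ℝ)) q * ψ q ∂doubleVolume := by
  have := Measure.isProbabilityMeasure_map (μ := sideMeasure ψ) measurable_sortKey.aemeasurable
  have hs : MeasurableSet {q | sortKey q ≤ sortKey p} := measurable_sortKey measurableSet_Iic
  rw [← sideMeasure_real_apply hψ hb hs]
  change ProbabilityTheory.cdf _ _ = _
  rw [ProbabilityTheory.cdf_eq_real, map_measureReal_apply measurable_sortKey measurableSet_Iic]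
  rfl

theorem measurable_rank (ψ : Bool × unitInterval → ℝ) : Measurable (rank ψ) :=
  (measurable_unitCdf _).comp measurable_sortKey

theorem isProbabilityMeasure_sideMeasure_side {A : Set unitInterval} (hA : MeasurableSet A) :
    IsProbabilityMeasure (sideMeasure (side A)) := by
  rw [← map_sideGraph hA]
  exact Measure.isProbabilityMeasure_map (measurable_sideGraph hA).aemeasurable

theorem exists_aeInverse_rank (ψ : Bool × unitInterval → ℝ) [IsProbabilityMeasure (sideMeasure ψ)] :
    ∃ S, AEInverse (rank ψ) S (sideMeasure ψ) volume :=
  exists_aeInverse_unitCdf _ measurable_sortKey sortKey_injective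

/-- The almost-bijection of the unit interval that moves `A` to an initial segment, preserving the
order within `A` and within its complement. -/
theorem exists_aeInverse_rank_sideGraph {A : Set unitInterval} (hA : MeasurableSet A) :
    ∃ δ, AEInverse (fun x => rank (side A) (sideGraph A x)) δ volume volume := by
  have h := exists_aeInverse_unitCdf (volume : Measure unitInterval)
    (measurable_sortKey.comp (measurable_sideGraph hA))
    (sortKey_injective.comp fun x y hxy => congrArg Prod.snd hxy)
  rw [← Measure.map_map measurable_sortKey (measurable_sideGraph hA), map_sideGraph hA] at h
  exact h

section Limits

variable {A : ℕ → Set unitInterval} {ψ : Bool × unitInterval → ℝ}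

theorem isProbabilityMeasure_sideMeasure_of_lim (hA : ∀ n, MeasurableSet (A n)) (hψ : Measurable ψ)
    (hb : ∀ p, ψ p ∈ Set.Icc (0 : ℝ) 1) (h : WeakStarLim doubleVolume (fun n => side (A n)) ψ) :
    IsProbabilityMeasure (sideMeasure ψ) := by
  have := isFiniteMeasure_sideMeasure hψ hb
  have h1 := h _ ((integrable_const (1 : ℝ)).indicator MeasurableSet.univ)
  rw [← sideMeasure_real_apply hψ hb MeasurableSet.univ] at h1
  have h2 : ∀ n, ∫ x, Set.univ.indicator (fun _ => (1 : ℝ)) x * side (A n) x ∂doubleVolume = 1 := by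
    intro n
    rw [← sideMeasure_real_apply (measurable_side (hA n)) (side_mem_Icc _) MeasurableSet.univ]
    have := isProbabilityMeasure_sideMeasure_side (hA n)
    exact probReal_univ
  simp only [h2] at h1
  have h3 := tendsto_nhds_unique h1 tendsto_const_nhds
  rw [measureReal_def, ENNReal.toReal_eq_one_iff] at h3
  exact ⟨h3⟩

/-- Each rank is the integral of the density over a fixed set, hence passes to weak* limits. -/
theorem tendsto_rank (hA : ∀ n, MeasurableSet (A n)) (hψ : Measurable ψ)
    (hb : ∀ p, ψ p ∈ Set.Icc (0 : ℝ) 1) (h : WeakStarLim doubleVolume (fun n => side (A n)) ψ)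
    (p : Bool × unitInterval) :
    Tendsto (fun n => rank (side (A n)) p) atTop (𝓝 (rank ψ p)) := by
  rw [tendsto_subtype_rng]
  have := isProbabilityMeasure_sideMeasure_of_lim hA hψ hb h
  rw [rank_coe hψ hb]
  have h2 : ∀ n, (rank (side (A n)) p : ℝ) = _ := fun n =>
    have := isProbabilityMeasure_sideMeasure_side (hA n)
    rank_coe (measurable_side (hA n)) (side_mem_Icc _) p
  simp only [h2]
  exact h _ ((integrable_const (1 : ℝ)).indicator (measurable_sortKey measurableSet_Iic))

end Limits

/-! ### Splitting and sorting graphons -/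

namespace Graphon

/-- The graphon `G`, seen on the square of the doubled interval split along `A`. -/
def split (A : Set unitInterval) (G : Graphon) (p : (Bool × unitInterval) × (Bool × unitInterval)) : ℝ :=
  side A p.1 * side A p.2 * G (unsheet p)

theorem aemeasurable_unsheet (G : Graphon) :
    AEMeasurable (fun p => G (unsheet p)) (doubleVolume.prod doubleVolume) :=
  G.lebesgueMeasurable.comp_quasiMeasurePreserving quasiMeasurePreserving_unsheet

theorem aemeasurable_split {A : Set unitInterval} (hA : MeasurableSet A) (G : Graphon) :
    AEMeasurable (split A G) (doubleVolume.prod doubleVolume) := by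
  have h := measurable_side hA
  have h2 := G.aemeasurable_unsheet
  unfold split
  fun_prop

theorem split_mem_Icc (A : Set unitInterval) (G : Graphon)
    (p : (Bool × unitInterval) × (Bool × unitInterval)) : split A G p ∈ Set.Icc (0 : ℝ) 1 :=
  unitInterval.mul_mem (unitInterval.mul_mem (side_mem_Icc _ _) (side_mem_Icc _ _)) (G.mem_Icc _)

/-- Integrals of the sorted graphon in terms of the split one. -/
theorem integral_mul_of_isVersionVia_rank {A : Set unitInterval} (hA : MeasurableSet A) {G G' : Graphon}
    {δ : unitInterval → unitInterval}
    (hG : IsVersionVia (fun x => rank (side A) (sideGraph A x)) δ G' G)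
    {g : unitInterval × unitInterval → ℝ} (hg : Measurable g) :
    ∫ z, g z * G' z = ∫ p, g (Prod.map (rank (side A)) (rank (side A)) p) * split A G p
      ∂(doubleVolume.prod doubleVolume) := by
  have hm := hG.1.prodMap_fwd
  have hl := measurable_sideGraph hA
  have hr := measurable_rank (side A)
  have hmp : MeasurePreserving (Prod.map (sideGraph A) (sideGraph A)) volume
      ((sideMeasure (side A)).prod (sideMeasure (side A))) := by
    have h : MeasurePreserving (sideGraph A) volume (sideMeasure (side A)) := ⟨hl, map_sideGraph hA⟩
    have := isProbabilityMeasure_sideMeasure_side hA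
    exact h.prod h
  have hac : (sideMeasure (side A)).prod (sideMeasure (side A)) ≪ doubleVolume.prod doubleVolume :=
    (withDensity_absolutelyContinuous _ _).prod (withDensity_absolutelyContinuous _ _)
  calc ∫ z, g z * G' z
      = ∫ z, g z * G' z ∂((volume : Measure (unitInterval × unitInterval)).map
          (Prod.map (fun x => rank (side A) (sideGraph A x)) (fun x => rank (side A) (sideGraph A x)))) := by
        rw [hm.map_eq]
    _ = ∫ z, g (Prod.map (rank (side A)) (rank (side A)) (Prod.map (sideGraph A) (sideGraph A) z))
          * G (unsheet (Prod.map (sideGraph A) (sideGraph A) z)) := by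
        rw [integral_map hm.measurable.aemeasurable (by
          rw [hm.map_eq]
          exact (hg.aemeasurable.mul G'.lebesgueMeasurable).aestronglyMeasurable)]
        refine integral_congr_ae ?_
        filter_upwards [hG.symm.2] with z hz
        rw [show G (unsheet (Prod.map (sideGraph A) (sideGraph A) z)) = G z from rfl, hz]
        rfl
    _ = ∫ p, g (Prod.map (rank (side A)) (rank (side A)) p) * G (unsheet p)
          ∂((sideMeasure (side A)).prod (sideMeasure (side A))) := by
        rw [← hmp.map_eq, integral_map hmp.measurable.aemeasurable]
        rw [hmp.map_eq]
        refine AEMeasurable.aestronglyMeasurable (AEMeasurable.mul ?_ (G.aemeasurable_unsheet.mono_ac hac))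
        exact (hg.comp (hr.prodMap hr)).aemeasurable
    _ = _ := by
        rw [integral_sideMeasure_prod (measurable_side hA) fun p => (side_mem_Icc A p).1]
        refine integral_congr_ae (ae_of_all _ fun p => ?_)
        simp only [split]
        ring

/-- The weak* limit `K` of the split graphons is, after division by the limit density `ψ ⊗ ψ`, the
pullback along `rank ψ` of the weak* limit of the sorted graphons. Both sides have the same image
under `rank ψ`, and this map is invertible modulo null sets. -/
theorem split_limit_ae_eq {A : ℕ → Set unitInterval} (hA : ∀ n, MeasurableSet (A n)) {G G' : ℕ → Graphon}
    {δ : ℕ → unitInterval → unitInterval}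
    (hG : ∀ n, IsVersionVia (fun x => rank (side (A n)) (sideGraph (A n) x)) (δ n) (G' n) (G n))
    {ψ : Bool × unitInterval → ℝ} (hψ : Measurable ψ) (hψb : ∀ p, ψ p ∈ Set.Icc (0 : ℝ) 1)
    (hlim : WeakStarLim doubleVolume (fun n => side (A n)) ψ)
    {K : (Bool × unitInterval) × (Bool × unitInterval) → ℝ} (hK : Measurable K)
    (hKb : ∀ p, K p ∈ Set.Icc (0 : ℝ) 1)
    (hKlim : WeakStarLim (doubleVolume.prod doubleVolume) (fun n => split (A n) (G n)) K)
    {W' : Graphon} (hW'm : Measurable W') (hW' : WeakStarTendsto G' W') :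
    ∀ᵐ p ∂(doubleVolume.prod doubleVolume),
      K p = ψ p.1 * ψ p.2 * W' (Prod.map (rank ψ) (rank ψ) p) := by
  have hprob := isProbabilityMeasure_sideMeasure_of_lim hA hψ hψb hlim
  obtain ⟨S, hS⟩ := exists_aeInverse_rank ψ
  have hSS := hS.prodMap
  have hr := measurable_rank ψ
  let T := Prod.map (rank ψ) (rank ψ)
  have hT : Measurable T := hr.prodMap hr
  let L : (Bool × unitInterval) × (Bool × unitInterval) → ℝ := fun p => ψ p.1 * ψ p.2 * W' (T p)
  have hψψ : Measurable fun p : (Bool × unitInterval) × (Bool × unitInterval) => ψ p.1 * ψ p.2 := by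
    fun_prop
  have hL : Measurable L := hψψ.mul (hW'm.comp hT)
  have hLb : ∀ p, L p ∈ Set.Icc (0 : ℝ) 1 := fun p =>
    unitInterval.mul_mem (unitInterval.mul_mem (hψb _) (hψb _)) (W'.mem_Icc _)
  have hint : ∀ F : (Bool × unitInterval) × (Bool × unitInterval) → ℝ, Measurable F →
      (∀ p, F p ∈ Set.Icc (0 : ℝ) 1) → Integrable F (doubleVolume.prod doubleVolume) := fun F hF hb =>
    integrable_of_abs_le_one hF.aemeasurable fun p => abs_le_one_of_mem_Icc (hb p)
  -- In particular `K` vanishes where `ψ ⊗ ψ` does, so that only the points where `rank ψ` is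
  -- invertible matter.
  have hle : K ≤ᵐ[doubleVolume.prod doubleVolume] fun p => ψ p.1 * ψ p.2 := by
    refine hKlim.ae_mono (hlim.tensor (fun n => measurable_side (hA n))
      (fun n p => abs_le_one_of_mem_Icc (side_mem_Icc _ p)) hψ fun p => abs_le_one_of_mem_Icc (hψb p))
      (fun n => ?_) (fun n => ?_) (hint K hK hKb) (hint _ hψψ fun p => unitInterval.mul_mem (hψb _) (hψb _)) ?_
    · exact integrable_of_abs_le_one (aemeasurable_split (hA n) _)
        fun p => abs_le_one_of_mem_Icc (split_mem_Icc _ _ p)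
    · have := measurable_side (hA n)
      exact hint _ (by fun_prop) fun p => unitInterval.mul_mem (side_mem_Icc _ _) (side_mem_Icc _ _)
    · intro n p
      exact mul_le_of_le_one_right (unitInterval.mul_mem (side_mem_Icc _ _) (side_mem_Icc _ _)).1 ((G n).mem_Icc _).2
  have hdom : ∀ F : (Bool × unitInterval) × (Bool × unitInterval) → ℝ,
      F ≤ᵐ[doubleVolume.prod doubleVolume] (fun p => ψ p.1 * ψ p.2) →
      (doubleVolume.prod doubleVolume).withDensity (fun p => ENNReal.ofReal (F p))
        ≪ (sideMeasure ψ).prod (sideMeasure ψ) := by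
    intro F hF
    rw [sideMeasure, prod_withDensity hψ.ennreal_ofReal hψ.ennreal_ofReal]
    refine Measure.absolutelyContinuous_of_le (withDensity_mono ?_)
    filter_upwards [hF] with p hp
    rw [← ENNReal.ofReal_mul (hψb _).1]
    exact ENNReal.ofReal_le_ofReal hp
  have hLle : L ≤ᵐ[doubleVolume.prod doubleVolume] fun p => ψ p.1 * ψ p.2 := ae_of_all _ fun p =>
    mul_le_of_le_one_right (unitInterval.mul_mem (hψb _) (hψb _)).1 (W'.mem_Icc _).2
  have hfin : ∀ F : (Bool × unitInterval) × (Bool × unitInterval) → ℝ, Measurable F →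
      (∀ p, F p ∈ Set.Icc (0 : ℝ) 1) → IsFiniteMeasure
        ((doubleVolume.prod doubleVolume).withDensity (fun p => ENNReal.ofReal (F p))) := fun F hF hb =>
    isFiniteMeasure_withDensity_ofReal (hint F hF hb).2
  have := hfin K hK hKb
  have := hfin L hL hLb
  -- Continuity of `g` lets the ranks for `side (A n)` be replaced by their limits.
  have htest : ∀ g : BoundedContinuousFunction (unitInterval × unitInterval) ℝ,
      ∫ p, g (T p) * K p ∂(doubleVolume.prod doubleVolume)
        = ∫ p, g (T p) * L p ∂(doubleVolume.prod doubleVolume) := by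
    intro g
    have hg : Measurable g := g.continuous.measurable
    have hgi : Integrable g (volume : Measure (unitInterval × unitInterval)) :=
      Integrable.of_bound hg.aestronglyMeasurable ‖g‖ (ae_of_all _ g.norm_coe_le_norm)
    have h1 := hW' g hgi
    simp only [fun n => integral_mul_of_isVersionVia_rank (hA n) (hG n) hg] at h1
    have h2 := hKlim.tendsto_integral_mul (fun n => aemeasurable_split (hA n) (G n))
      (fun n p => abs_le_one_of_mem_Icc (split_mem_Icc _ _ p))
      (g := fun n p => g (Prod.map (rank (side (A n))) (rank (side (A n))) p)) (g' := fun p => g (T p))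
      (C := ‖g‖) (fun n => ?_) (hg.comp hT).aemeasurable (fun n p => g.norm_coe_le_norm _)
      (fun p => g.norm_coe_le_norm _) (ae_of_all _ fun p => ?_)
    · rw [tendsto_nhds_unique h2 h1]
      conv_lhs => rw [show (volume : Measure (unitInterval × unitInterval)) = volume.prod volume from rfl,
        ← hSS.fwd.map_eq]
      have hgW : Measurable fun z => g z * W' z := hg.mul hW'm
      rw [integral_map hSS.fwd.measurable.aemeasurable hgW.aestronglyMeasurable,
        integral_sideMeasure_prod hψ fun p => (hψb p).1]
      refine integral_congr_ae (ae_of_all _ fun p => ?_)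
      simp only [L, T]
      ring
    · have := measurable_rank (side (A n))
      exact (hg.comp (this.prodMap this)).aemeasurable
    · exact (g.continuous.tendsto _).comp ((tendsto_rank hA hψ hψb hlim p.1).prodMk_nhds
        (tendsto_rank hA hψ hψb hlim p.2))
  have hmap : ((doubleVolume.prod doubleVolume).withDensity (fun p => ENNReal.ofReal (K p))).map T
      = ((doubleVolume.prod doubleVolume).withDensity (fun p => ENNReal.ofReal (L p))).map T := by
    refine ext_of_forall_integral_eq_of_IsFiniteMeasure fun g => ?_
    have hg : Measurable g := g.continuous.measurable
    rw [integral_map hT.aemeasurable hg.aestronglyMeasurable,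
      integral_map hT.aemeasurable hg.aestronglyMeasurable,
      integral_withDensity_eq_integral_toReal_smul hK.ennreal_ofReal (ae_of_all _ fun _ => ENNReal.ofReal_lt_top),
      integral_withDensity_eq_integral_toReal_smul hL.ennreal_ofReal (ae_of_all _ fun _ => ENNReal.ofReal_lt_top)]
    simp only [smul_eq_mul, fun p => ENNReal.toReal_ofReal (hKb p).1, fun p => ENNReal.toReal_ofReal (hLb p).1,
      mul_comm _ (g _)]
    exact htest g
  have heq := hSS.eq_of_map_eq (hdom K hle) (hdom L hLle) hmap
  rw [withDensity_eq_iff_of_sigmaFinite hK.ennreal_ofReal.aemeasurable hL.ennreal_ofReal.aemeasurable] at heq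
  filter_upwards [heq] with p hp
  exact (ENNReal.ofReal_eq_ofReal_iff (hKb p).1 (hLb p).1).1 hp

/-! ### Refinements -/

/-- Data exhibiting `W'` as a refinement of `W`: at almost every point of the square, `W` is a convex
combination, with weights `w c`, of four values `V c` of `W'`, and `INT f W'` is the integral of the
corresponding combination of the `f (V c)`. The number `ε` bounds from below how far the value with
index `(true, true)` is from `W` on average. -/
structure Refinement (ε : ℝ) (W' W : Graphon) where
  w : Bool × Bool → unitInterval × unitInterval → ℝ
  V : Bool × Bool → unitInterval × unitInterval → ℝ
  measurable_w : ∀ c, Measurable (w c)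
  measurable_V : ∀ c, Measurable (V c)
  w_mem : ∀ c z, w c z ∈ Set.Icc (0 : ℝ) 1
  V_mem : ∀ c z, V c z ∈ Set.Icc (0 : ℝ) 1
  sum_w : ∀ᵐ z, ∑ c, w c z = 1
  sum_wV : ∀ᵐ z, W z = ∑ c, w c z * V c z
  INT_eq : ∀ f : ℝ → ℝ, ContinuousOn f (Set.Icc 0 1) → INT f W' = ∫ z, ∑ c, w c z * f (V c z)
  gap : ε ≤ |∫ z, w (true, true) z * (V (true, true) z - W z)|

/-- Jensen's inequality, which is strict since the values averaged are not almost everywhere equal. -/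
theorem Refinement.INT_lt {ε : ℝ} {W' W : Graphon} (h : Refinement ε W' W) (hε : 0 < ε) {f : ℝ → ℝ}
    (hf : ContinuousOn f (Set.Icc 0 1)) (hfc : StrictConcaveOn ℝ (Set.Icc 0 1) f) :
    INT f W' < INT f W := by
  have hint : Integrable (fun z => ∑ c, h.w c z * f (h.V c z)) volume := by
    refine integrable_finsetSum _ fun c _ => ?_
    simp only [mul_comm (h.w c _)]
    exact integrable_mul_of_abs_le_one
      (integrable_comp_of_continuousOn hf (h.measurable_V c).aemeasurable (h.V_mem c))
      (h.measurable_w c).aemeasurable fun z => abs_le_one_of_mem_Icc (h.w_mem c z)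
  have hint' : Integrable (fun z => f (W z)) volume :=
    integrable_comp_of_continuousOn hf W.lebesgueMeasurable W.mem_Icc
  have hle : (fun z => ∑ c, h.w c z * f (h.V c z)) ≤ᵐ[volume] fun z => f (W z) := by
    filter_upwards [h.sum_w, h.sum_wV] with z h1 h2
    simp only [h2, ← smul_eq_mul]
    exact hfc.concaveOn.le_map_sum (fun c _ => (h.w_mem c z).1) h1 fun c _ => h.V_mem c z
  rw [h.INT_eq f hf]
  refine lt_of_le_of_ne (integral_mono_ae hint hint' hle) fun heq => ?_
  rw [INT, integral_eq_iff_of_ae_le hint hint' hle] at heq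
  have h0 : ∫ z, h.w (true, true) z * (h.V (true, true) z - W z) = 0 := by
    refine integral_eq_zero_of_ae ?_
    filter_upwards [h.sum_w, h.sum_wV, heq] with z h1 h2 h3
    have h4 := (hfc.map_sum_eq_iff' (fun c _ => (h.w_mem c z).1) h1 (fun c _ => h.V_mem c z)).1
    simp only [smul_eq_mul, ← h2] at h4
    by_cases hw : h.w (true, true) z = 0
    · simp [hw]
    · simp [← h4 h3.symm (true, true) (Finset.mem_univ _) hw]
  have := h.gap
  rw [h0, abs_zero] at this
  linarith

/-- For the square, the defect in Jensen's inequality is the variance of the values averaged, and the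
top sheet alone contributes at least `ε ^ 2` by the Cauchy–Schwarz inequality. -/
theorem Refinement.INT_sq_add_le {ε : ℝ} {W' W : Graphon} (h : Refinement ε W' W) (hε : 0 ≤ ε) :
    INT (fun t => t ^ 2) W + ε ^ 2 ≤ INT (fun t => t ^ 2) W' := by
  have hf : ContinuousOn (fun t : ℝ => t ^ 2) (Set.Icc 0 1) := by fun_prop
  let u : unitInterval × unitInterval → ℝ := fun z => h.w (true, true) z * (h.V (true, true) z - W z)
  have hum : AEMeasurable u volume := by
    have h1 := h.measurable_w (true, true)
    have h2 := h.measurable_V (true, true)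
    have h3 := W.lebesgueMeasurable
    fun_prop
  have hub : ∀ z, |u z| ≤ 1 := by
    intro z
    have h1 := h.w_mem (true, true) z
    have h2 := h.V_mem (true, true) z
    have h3 := W.mem_Icc z
    rw [abs_mul]
    exact mul_le_one₀ (abs_le_one_of_mem_Icc h1) (abs_nonneg _)
      (abs_le.2 ⟨by linarith [h2.1, h3.2], by linarith [h2.2, h3.1]⟩)
  have hu : Integrable u volume := integrable_of_abs_le_one hum hub
  have hu2 : Integrable (fun z => u z ^ 2) volume := by
    refine integrable_of_abs_le_one (hum.pow_const 2) fun z => ?_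
    rw [abs_pow]
    exact pow_le_one₀ (abs_nonneg _) (hub z)
  have hvar : (∫ z, u z) ^ 2 ≤ ∫ z, u z ^ 2 := by
    set m := ∫ z, u z with hm
    have h0 : 0 ≤ ∫ z, (u z ^ 2 - 2 * m * u z + m ^ 2) :=
      integral_nonneg fun z => by simp only [Pi.zero_apply]; nlinarith [sq_nonneg (u z - m)]
    have h1 : Integrable (fun z => u z ^ 2 - 2 * m * u z) volume := hu2.sub (hu.const_mul _)
    rw [integral_add h1 (integrable_const _), integral_sub hu2 (hu.const_mul _), integral_const_mul,
      ← hm] at h0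
    simp only [integral_const, probReal_univ, one_smul] at h0
    nlinarith
  have hint : Integrable (fun z => ∑ c, h.w c z * h.V c z ^ 2) volume := by
    refine integrable_finsetSum _ fun c _ => ?_
    simp only [mul_comm (h.w c _)]
    exact integrable_mul_of_abs_le_one
      (integrable_comp_of_continuousOn hf (h.measurable_V c).aemeasurable (h.V_mem c))
      (h.measurable_w c).aemeasurable fun z => abs_le_one_of_mem_Icc (h.w_mem c z)
  have hint' : Integrable (fun z => W z ^ 2) volume :=
    integrable_comp_of_continuousOn hf W.lebesgueMeasurable W.mem_Icc
  have hgap : ε ^ 2 ≤ (∫ z, u z) ^ 2 := by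
    rw [← sq_abs (∫ z, u z)]
    exact pow_le_pow_left₀ hε h.gap 2
  have hmono : ∫ z, (W z ^ 2 + u z ^ 2) ≤ ∫ z, ∑ c, h.w c z * h.V c z ^ 2 := by
    refine integral_mono_ae (hint'.add hu2) hint ?_
    filter_upwards [h.sum_w, h.sum_wV] with z h1 h2
    have h3 : ∑ c, h.w c z * (h.V c z - W z) ^ 2 = ∑ c, h.w c z * h.V c z ^ 2 - W z ^ 2 := by
      have : ∀ c, h.w c z * (h.V c z - W z) ^ 2
          = h.w c z * h.V c z ^ 2 - 2 * W z * (h.w c z * h.V c z) + W z ^ 2 * h.w c z := fun c => by ring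
      simp only [this, Finset.sum_add_distrib, Finset.sum_sub_distrib, ← Finset.mul_sum, h1, ← h2]
      ring
    have h4 := Finset.single_le_sum (f := fun c => h.w c z * (h.V c z - W z) ^ 2)
      (fun c _ => mul_nonneg (h.w_mem c z).1 (sq_nonneg _)) (Finset.mem_univ (true, true))
    have h5 : u z ^ 2 ≤ h.w (true, true) z * (h.V (true, true) z - W z) ^ 2 := by
      simp only [u, mul_pow]
      refine mul_le_mul_of_nonneg_right ?_ (sq_nonneg _)
      have := h.w_mem (true, true) z
      nlinarith [this.1, this.2]
    linarith
  rw [integral_add hint' hu2] at hmono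
  rw [h.INT_eq _ hf]
  change (∫ z, W z ^ 2) + ε ^ 2 ≤ _
  linarith

/-- The indicator of the sheet with index `(true, true)`. -/
def topSheet (p : (Bool × unitInterval) × (Bool × unitInterval)) : ℝ :=
  if p.1.1 = true ∧ p.2.1 = true then 1 else 0

theorem measurable_topSheet : Measurable topSheet := by
  refine Measurable.ite ?_ measurable_const measurable_const
  exact (measurableSet_eq_fun (measurable_fst.comp measurable_fst) measurable_const).inter
    (measurableSet_eq_fun (measurable_fst.comp measurable_snd) measurable_const)

theorem abs_topSheet_le_one (p : (Bool × unitInterval) × (Bool × unitInterval)) : |topSheet p| ≤ 1 := by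
  unfold topSheet; split_ifs <;> simp

theorem integral_topSheet_mul {F : (Bool × unitInterval) × (Bool × unitInterval) → ℝ}
    (hF : Integrable F (doubleVolume.prod doubleVolume)) :
    ∫ p, topSheet p * F p ∂(doubleVolume.prod doubleVolume) = ∫ z, F (sheet (true, true) z) := by
  have hi : Integrable (fun p => topSheet p * F p) (doubleVolume.prod doubleVolume) := by
    simp only [mul_comm (topSheet _)]
    exact integrable_mul_of_abs_le_one hF measurable_topSheet.aemeasurable abs_topSheet_le_one
  rw [integral_doubleVolume_prod hi]
  simp [Fintype.sum_prod_type, topSheet, sheet]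

theorem sum_sheet_side (A : Set unitInterval) (z : unitInterval × unitInterval) :
    ∑ c, side A (sheet c z).1 * side A (sheet c z).2 = 1 := by
  by_cases h1 : z.1 ∈ A <;> by_cases h2 : z.2 ∈ A <;> simp [Fintype.sum_prod_type, side, sheet, h1, h2]

theorem sum_sheet_split (A : Set unitInterval) (G : Graphon) (z : unitInterval × unitInterval) :
    ∑ c, split A G (sheet c z) = G z := by
  simp only [split, unsheet_sheet, ← Finset.sum_mul, sum_sheet_side, one_mul]

theorem side_sheet_true (A : Set unitInterval) (G : Graphon) (z : unitInterval × unitInterval) :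
    side A (sheet (true, true) z).1 * side A (sheet (true, true) z).2 * G z
      = (A ×ˢ A).indicator G z := by
  by_cases h1 : z.1 ∈ A <;> by_cases h2 : z.2 ∈ A <;> simp [side, sheet, h1, h2, Set.indicator]

/-- If `G n` converges weak* to `W` but not along the squares of the sets `A n`, then sorting the
points of the interval according to membership in `A n` produces, in the limit, a proper refinement
of `W`. -/
theorem exists_refinement {G : ℕ → Graphon} {W : Graphon} (hG : WeakStarTendsto G W)
    {A : ℕ → Set unitInterval} (hA : ∀ n, MeasurableSet (A n)) {ε : ℝ}
    (hε : ∀ n, ε ≤ |∫ z in A n ×ˢ A n, (G n z - W z)|) :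
    ∃ j : ℕ → ℕ, StrictMono j ∧ ∃ (G' : ℕ → Graphon) (W' : Graphon),
      (∀ n, IsVersion (G' n) (G (j n))) ∧ WeakStarTendsto G' W' ∧ Nonempty (Refinement ε W' W) := by
  obtain ⟨j₁, hj₁, ψ, hψ, hψb, hlim⟩ := exists_weakStarLim_subseq (μ := doubleVolume)
    (fun n => (measurable_side (hA n)).aemeasurable) fun n => side_mem_Icc (A n)
  obtain ⟨j₂, hj₂, K, hK, hKb, hKlim⟩ := exists_weakStarLim_subseq (μ := doubleVolume.prod doubleVolume)
    (fun n => aemeasurable_split (hA (j₁ n)) (G (j₁ n))) fun n => split_mem_Icc (A (j₁ n)) (G (j₁ n))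
  choose δ hδ using fun n => exists_aeInverse_rank_sideGraph (hA n)
  obtain ⟨j₃, hj₃, W', hW'm, hW'⟩ := exists_weakStarTendsto_subseq
    fun n => (G (j₁ (j₂ n))).pullback (hδ (j₁ (j₂ n))).bwd
  let j : ℕ → ℕ := fun n => j₁ (j₂ (j₃ n))
  have hj : StrictMono j := hj₁.comp (hj₂.comp hj₃)
  have hver : ∀ n, IsVersionVia (fun x => rank (side (A (j n))) (sideGraph (A (j n)) x)) (δ (j n))
      ((G (j n)).pullback (hδ (j n)).bwd) (G (j n)) := fun n => isVersionVia_pullback _ (hδ (j n))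
  replace hlim : WeakStarLim doubleVolume (fun n => side (A (j n))) ψ := hlim.subseq (hj₂.comp hj₃)
  replace hKlim : WeakStarLim (doubleVolume.prod doubleVolume) (fun n => split (A (j n)) (G (j n))) K :=
    hKlim.subseq hj₃
  refine ⟨j, hj, fun n => (G (j n)).pullback (hδ (j n)).bwd, W', fun n =>
    isVersion_iff.2 ⟨_, _, hver n⟩, hW', ?_⟩
  have hKeq := split_limit_ae_eq (fun n => hA (j n)) hver hψ hψb hlim hK hKb hKlim hW'm hW'
  have hprob := isProbabilityMeasure_sideMeasure_of_lim (fun n => hA (j n)) hψ hψb hlim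
  obtain ⟨S, hS⟩ := exists_aeInverse_rank ψ
  have hr := measurable_rank ψ
  have hKs : ∀ c, ∀ᵐ z, K (sheet c z)
      = ψ (sheet c z).1 * ψ (sheet c z).2 * W' (Prod.map (rank ψ) (rank ψ) (sheet c z)) := fun c =>
    (quasiMeasurePreserving_sheet c).ae hKeq
  have hψlim := hlim.tensor (fun n => measurable_side (hA (j n)))
    (fun n p => abs_le_one_of_mem_Icc (side_mem_Icc _ p)) hψ fun p => abs_le_one_of_mem_Icc (hψb p)
  have hψψ : Measurable fun p : (Bool × unitInterval) × (Bool × unitInterval) => ψ p.1 * ψ p.2 := by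
    fun_prop
  have hψψb : ∀ p : (Bool × unitInterval) × (Bool × unitInterval), ψ p.1 * ψ p.2 ∈ Set.Icc (0 : ℝ) 1 :=
    fun p => unitInterval.mul_mem (hψb _) (hψb _)
  have hss : ∀ n, Measurable fun p : (Bool × unitInterval) × (Bool × unitInterval) =>
      side (A (j n)) p.1 * side (A (j n)) p.2 := fun n => by
    have := measurable_side (hA (j n))
    fun_prop
  have hssb : ∀ n, ∀ p : (Bool × unitInterval) × (Bool × unitInterval),
      |side (A (j n)) p.1 * side (A (j n)) p.2| ≤ 1 :=
    fun n p => abs_le_one_of_mem_Icc (unitInterval.mul_mem (side_mem_Icc _ _) (side_mem_Icc _ _))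
  have hint : ∀ c, ∀ F : (Bool × unitInterval) × (Bool × unitInterval) → ℝ, Measurable F →
      (∀ p, F p ∈ Set.Icc (0 : ℝ) 1) → Integrable (fun z => F (sheet c z)) volume := fun c F hF hb =>
    (integrable_of_abs_le_one hF.aemeasurable fun p => abs_le_one_of_mem_Icc (hb p)).comp_sheet c
  refine ⟨⟨fun c z => ψ (sheet c z).1 * ψ (sheet c z).2,
    fun c z => W' (Prod.map (rank ψ) (rank ψ) (sheet c z)), fun c => hψψ.comp (measurable_sheet c),
    fun c => hW'm.comp ((hr.prodMap hr).comp (measurable_sheet c)), fun c z => hψψb _,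
    fun c z => W'.mem_Icc _, ?_, ?_, ?_, ?_⟩⟩
  · have h1 := hψlim.sum_sheet (fun n => (hss n).aemeasurable) hssb hψψ.aemeasurable
      fun p => abs_le_one_of_mem_Icc (hψψb p)
    simp only [sum_sheet_side] at h1
    exact h1.ae_unique (integrable_finsetSum _ fun c _ => hint c _ hψψ hψψb) (integrable_const _)
      fun g hg => tendsto_const_nhds
  · have h1 := hKlim.sum_sheet (fun n => aemeasurable_split (hA (j n)) _)
      (fun n p => abs_le_one_of_mem_Icc (split_mem_Icc _ _ p)) hK.aemeasurable
      fun p => abs_le_one_of_mem_Icc (hKb p)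
    simp only [sum_sheet_split] at h1
    have h2 := WeakStarLim.ae_unique W.integrable
      (integrable_finsetSum _ fun c _ => hint c _ hK hKb) (hG.subseq hj) h1
    filter_upwards [h2, ae_all_iff.2 hKs] with z hz hc
    rw [hz]
    exact Finset.sum_congr rfl fun c _ => hc c
  · intro f hf
    have hSS := hS.prodMap
    have hfi : ∀ {X : Type} [MeasurableSpace X] {μ : Measure X} [IsFiniteMeasure μ]
        {u : X → unitInterval × unitInterval}, Measurable u → Integrable (fun x => f (W' (u x))) μ :=
      fun {X} _ {μ} _ {u} hu => integrable_comp_of_continuousOn hf (hW'm.comp hu).aemeasurable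
        fun x => W'.mem_Icc _
    have h1 : INT f W' = ∫ p, ψ p.1 * ψ p.2 * f (W' (Prod.map (rank ψ) (rank ψ) p))
        ∂(doubleVolume.prod doubleVolume) := by
      rw [← integral_sideMeasure_prod hψ fun p => (hψb p).1]
      rw [INT, show (volume : Measure (unitInterval × unitInterval)) = volume.prod volume from rfl,
        ← hSS.fwd.map_eq]
      exact integral_map hSS.fwd.measurable.aemeasurable (hfi measurable_id).1
    have h2 : Integrable (fun p => ψ p.1 * ψ p.2 * f (W' (Prod.map (rank ψ) (rank ψ) p)))
        (doubleVolume.prod doubleVolume) := by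
      simp only [mul_comm (ψ _ * ψ _)]
      exact integrable_mul_of_abs_le_one (hfi (hr.prodMap hr)) hψψ.aemeasurable
        fun p => abs_le_one_of_mem_Icc (hψψb p)
    rw [h1, integral_doubleVolume_prod h2, integral_finsetSum _ fun c _ => h2.comp_sheet c]
  · have hWi := W.integrable.comp_unsheet
    have hsplit : ∀ n, Integrable (split (A (j n)) (G (j n))) (doubleVolume.prod doubleVolume) := fun n =>
      integrable_of_abs_le_one (aemeasurable_split (hA (j n)) _)
        fun p => abs_le_one_of_mem_Icc (split_mem_Icc _ _ p)
    have htop : Integrable topSheet (doubleVolume.prod doubleVolume) :=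
      integrable_of_abs_le_one measurable_topSheet.aemeasurable abs_topSheet_le_one
    have htopW : Integrable (fun p => topSheet p * W (unsheet p)) (doubleVolume.prod doubleVolume) := by
      simp only [mul_comm (topSheet _)]
      exact integrable_mul_of_abs_le_one hWi measurable_topSheet.aemeasurable abs_topSheet_le_one
    have h1 := hKlim _ htop
    have h2 := hψlim _ htopW
    have hWψ := integrable_mul_of_abs_le_one hWi hψψ.aemeasurable
      fun p => abs_le_one_of_mem_Icc (hψψb p)
    have e1 : ∀ n, ∫ p, topSheet p * split (A (j n)) (G (j n)) p ∂(doubleVolume.prod doubleVolume)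
        = ∫ z in A (j n) ×ˢ A (j n), G (j n) z := by
      intro n
      rw [integral_topSheet_mul (hsplit n), ← integral_indicator ((hA _).prod (hA _))]
      simp only [split, unsheet_sheet, side_sheet_true]
    have e2 : ∀ n, ∫ p, topSheet p * W (unsheet p) * (side (A (j n)) p.1 * side (A (j n)) p.2)
        ∂(doubleVolume.prod doubleVolume) = ∫ z in A (j n) ×ˢ A (j n), W z := by
      intro n
      simp only [mul_assoc]
      rw [integral_topSheet_mul (integrable_mul_of_abs_le_one hWi (hss n).aemeasurable (hssb n)),
        ← integral_indicator ((hA _).prod (hA _))]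
      simp only [unsheet_sheet, mul_comm (W _), side_sheet_true]
    simp only [e1] at h1
    simp only [e2] at h2
    rw [integral_topSheet_mul (integrable_of_abs_le_one hK.aemeasurable fun p =>
      abs_le_one_of_mem_Icc (hKb p)), integral_congr_ae (hKs (true, true))] at h1
    simp only [mul_assoc (topSheet _)] at h2
    rw [integral_topSheet_mul hWψ] at h2
    have h3 := (h1.sub h2).abs
    simp only [mul_sub]
    rw [integral_sub]
    · simp only [unsheet_sheet, mul_comm (W _)] at h3
      refine ge_of_tendsto' h3 fun n => (hε (j n)).trans_eq
        (congrArg abs (integral_sub (G (j n)).integrable.integrableOn W.integrable.integrableOn))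
    · exact (hint (true, true) K hK hKb).congr (hKs (true, true))
    · simpa only [unsheet_sheet, mul_comm (W _)] using hWψ.comp_sheet (true, true)

/-! ### Accumulation points and compactness -/

/-- Versions chosen along a subsequence extend to the whole sequence; elsewhere the graphon itself is
taken. -/
theorem exists_versions_extending {Γ : ℕ → Graphon} {k : ℕ → ℕ} (hk : StrictMono k) {V : ℕ → Graphon}
    (hV : ∀ n, IsVersion (V n) (Γ (k n))) :
    ∃ Γ' : ℕ → Graphon, (∀ n, IsVersion (Γ' n) (Γ n)) ∧ ∀ n, Γ' (k n) = V n := by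
  classical
  refine ⟨fun m => if h : ∃ n, k n = m then V h.choose else Γ m, fun m => ?_, fun n => ?_⟩
  · by_cases h : ∃ n, k n = m
    · simp only [h, dite_true]
      have := hV h.choose
      rwa [h.choose_spec] at this
    · simp only [h, dite_false]
      exact isVersion_refl _
  · have h : ∃ n', k n' = k n := ⟨n, rfl⟩
    simp only [h, dite_true]
    rw [hk.injective h.choose_spec]

/-- In the definition of `ACC` it suffices to choose versions along the subsequence. -/
theorem mem_ACC_of_subseq {Γ : ℕ → Graphon} {k : ℕ → ℕ} (hk : StrictMono k) {V : ℕ → Graphon}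
    (hV : ∀ n, IsVersion (V n) (Γ (k n))) {W : Graphon} (h : WeakStarTendsto V W) : W ∈ ACC Γ := by
  obtain ⟨Γ', h1, h2⟩ := exists_versions_extending hk hV
  refine ⟨Γ', h1, k, hk, ?_⟩
  simpa only [h2] using h

theorem ACC_nonempty (Γ : ℕ → Graphon) : (ACC Γ).Nonempty := by
  obtain ⟨k, hk, W, -, hW⟩ := exists_weakStarTendsto_subseq Γ
  exact ⟨W, Γ, fun n => isVersion_refl _, k, hk, hW⟩

/-- A weak* limit that the sequence does not approach within `ε` in the cut norm has a proper
refinement, which is again a weak* limit of versions. -/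
theorem exists_refinement_of_not_frequently {G : ℕ → Graphon} {W : Graphon} (hG : WeakStarTendsto G W)
    {ε : ℝ} (hε : 0 < ε) (h : ¬ ∃ᶠ n in atTop, cutDist (G n) W < ε) :
    ∃ j : ℕ → ℕ, StrictMono j ∧ ∃ (G' : ℕ → Graphon) (W' : Graphon),
      (∀ n, IsVersion (G' n) (G (j n))) ∧ WeakStarTendsto G' W' ∧
        Nonempty (Refinement (ε / 2) W' W) := by
  rw [not_frequently, eventually_atTop] at h
  obtain ⟨N, hN⟩ := h
  have hshift : StrictMono fun n => n + N := fun a b hab => Nat.add_lt_add_right hab N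
  have hA : ∀ n, ∃ A : Set unitInterval, MeasurableSet A ∧
      ε / 2 < |∫ z in A ×ˢ A, (G (n + N) z - W z)| := fun n =>
    exists_lt_of_lt_cutNorm ((half_lt_self hε).trans_le (not_lt.1 (hN (n + N) (Nat.le_add_left _ _))))
  choose A hAm hA using hA
  obtain ⟨j, hj, G', W', h1, h2, h3⟩ := exists_refinement (hG.subseq hshift) hAm fun n => (hA n).le
  exact ⟨fun n => j n + N, hshift.comp hj, G', W', h1, h2, h3⟩

/-- A weak* accumulation point that is not a cut norm accumulation point does not minimise `INT f`. -/
theorem exists_INT_lt_of_not_isCutNormAccPt {f : ℝ → ℝ} (hf : ContinuousOn f (Set.Icc 0 1))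
    (hfc : StrictConcaveOn ℝ (Set.Icc 0 1) f) {Γ : ℕ → Graphon} {W : Graphon} (hW : W ∈ ACC Γ)
    (h : ¬ IsCutNormAccPt Γ W) : ∃ W' ∈ ACC Γ, INT f W' < INT f W := by
  obtain ⟨Γ', hΓ', k, hk, hlim⟩ := hW
  have hfar : ∃ ε > 0, ¬ ∃ᶠ n in atTop, cutDist (Γ' (k n)) W < ε := by
    by_contra! hclose
    obtain ⟨l, hl, hl'⟩ := extraction_forall_of_frequently
      fun n : ℕ => hclose (1 / ((n : ℝ) + 1)) (by positivity)
    refine h ⟨Γ', hΓ', fun n => k (l n), hk.comp hl, ?_⟩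
    exact squeeze_zero (fun n => cutDist_nonneg _ _) (fun n => (hl' n).le)
      tendsto_one_div_add_atTop_nhds_zero_nat
  obtain ⟨ε, hε, hfar⟩ := hfar
  obtain ⟨j, hj, G', W', h1, h2, ⟨h3⟩⟩ := exists_refinement_of_not_frequently hlim hε hfar
  exact ⟨W', mem_ACC_of_subseq (hk.comp hj) (fun n => (h1 n).trans (hΓ' _)) h2,
    h3.INT_lt (by positivity) hf hfc⟩

/-- `INT` of the square is bounded, which makes near-maximisers available. -/
theorem INT_sq_le_one (W : Graphon) : INT (fun t => t ^ 2) W ≤ 1 := by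
  have h : Integrable (fun z => W z ^ 2) volume :=
    integrable_comp_of_continuousOn (f := fun t => t ^ 2) (by fun_prop) W.lebesgueMeasurable W.mem_Icc
  calc INT (fun t => t ^ 2) W ≤ ∫ _ : unitInterval × unitInterval, (1 : ℝ) :=
        integral_mono h (integrable_const _) fun z => pow_le_one₀ (W.mem_Icc z).1 (W.mem_Icc z).2
    _ = 1 := by simp

/-- Up to versions, every sequence of graphons has a subsequence inside a cut norm ball of radius `ε`.
Its centre is an element of `ACC Γ` for which `∫∫ W ^ 2` is almost maximal: a refinement would gain a
definite amount. -/
theorem exists_subseq_cutNear (Γ : ℕ → Graphon) {ε : ℝ} (hε : 0 < ε) :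
    ∃ k : ℕ → ℕ, StrictMono k ∧ ∃ W, ∀ n, CutNear ε (Γ (k n)) W := by
  let s := INT (fun t => t ^ 2) '' ACC Γ
  have hs : s.Nonempty := (ACC_nonempty Γ).image _
  have hbdd : BddAbove s := ⟨1, by rintro _ ⟨W, -, rfl⟩; exact INT_sq_le_one W⟩
  obtain ⟨_, ⟨W, hW, rfl⟩, hlt⟩ := exists_lt_of_lt_csSup hs
    (show sSup s - (ε / 2) ^ 2 < sSup s from sub_lt_self _ (by positivity))
  obtain ⟨Γ', hΓ', k, hk, hlim⟩ := hW
  by_cases h : ∃ᶠ n in atTop, cutDist (Γ' (k n)) W < ε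
  · obtain ⟨l, hl, hl'⟩ := extraction_of_frequently_atTop h
    exact ⟨fun n => k (l n), hk.comp hl, W, fun n => ⟨_, hΓ' _, (hl' n).le⟩⟩
  · obtain ⟨j, hj, G', W', h1, h2, ⟨h3⟩⟩ := exists_refinement_of_not_frequently hlim hε h
    have hW' : W' ∈ ACC Γ := mem_ACC_of_subseq (hk.comp hj) (fun n => (h1 n).trans (hΓ' _)) h2
    have h4 := h3.INT_sq_add_le (by positivity)
    have h5 := le_csSup hbdd (Set.mem_image_of_mem (INT fun t => t ^ 2) hW')
    linarith

/-- A diagonal subsequence, consecutive terms of which are summably close up to versions. -/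
theorem exists_subseq_cutNear_succ (Γ : ℕ → Graphon) :
    ∃ k : ℕ → ℕ, StrictMono k ∧ ∀ n, CutNear ((1 / 2) ^ n) (Γ (k (n + 1))) (Γ (k n)) := by
  have hpos : ∀ j : ℕ, (0 : ℝ) < (1 / 2) ^ j / 2 := fun j => by positivity
  choose φ hφ W hW using fun (Γ : ℕ → Graphon) (j : ℕ) => exists_subseq_cutNear Γ (hpos j)
  -- The `j`-th nested subsequence.
  let K : ℕ → ℕ → ℕ := fun j => Nat.rec id (fun i κ => κ ∘ φ (Γ ∘ κ) i) j
  have hKs : ∀ j, K (j + 1) = K j ∘ φ (Γ ∘ K j) j := fun j => rfl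
  have hK : ∀ j, StrictMono (K j) := by
    intro j
    induction j with
    | zero => exact strictMono_id
    | succ j ih => rw [hKs]; exact ih.comp (hφ _ _)
  have hd : StrictMono fun n => K n n := by
    refine strictMono_nat_of_lt_succ fun n => ?_
    rw [hKs]
    exact hK n ((Nat.lt_succ_self n).trans_le ((hφ _ _).le_apply))
  have hnear : ∀ j l, CutNear ((1 / 2) ^ j / 2) (Γ (K (j + 1) l)) (W (Γ ∘ K j) j) := fun j l => by
    rw [hKs]; exact hW (Γ ∘ K j) j l
  refine ⟨fun n => K (n + 1) (n + 1), hd.comp (strictMono_id.add_const 1), fun n => ?_⟩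
  have h1 := hnear n (n + 1)
  have h2 : CutNear ((1 / 2) ^ n / 2) (Γ (K (n + 1 + 1) (n + 1 + 1))) (W (Γ ∘ K n) n) := by
    rw [hKs (n + 1)]
    exact hnear n _
  have h3 := h2.trans h1.symm
  rwa [add_halves] at h3

/-- Compactness of the space of graphons in the cut distance, for sequences. -/
theorem exists_subseq_cutDist_tendsto (Γ : ℕ → Graphon) :
    ∃ k : ℕ → ℕ, StrictMono k ∧ ∃ (D : ℕ → Graphon) (U : Graphon),
      (∀ n, IsVersion (D n) (Γ (k n))) ∧ U ∈ ACC (fun n => Γ (k n)) ∧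
        Tendsto (fun n => cutDist (D n) U) atTop (𝓝 0) := by
  obtain ⟨k, hk, hnear⟩ := exists_subseq_cutNear_succ Γ
  have step : ∀ n (U : {U // IsVersion U (Γ (k n))}), ∃ U' : {U // IsVersion U (Γ (k (n + 1)))},
      cutDist U' U ≤ (1 / 2) ^ n := by
    rintro n ⟨U, hU⟩
    obtain ⟨U', hU', hd⟩ := (hnear n).version_right hU
    exact ⟨⟨U', hU'⟩, hd⟩
  -- Choose the versions one after the other, each close to the preceding one.
  choose F hF using step
  let D : ∀ n, {U // IsVersion U (Γ (k n))} := fun n =>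
    Nat.rec (motive := fun n => {U // IsVersion U (Γ (k n))}) ⟨Γ (k 0), isVersion_refl _⟩
      (fun n U => F n U) n
  have hD : ∀ n, cutDist (D (n + 1)).1 (D n).1 ≤ (1 / 2) ^ n := fun n => hF n (D n)
  have hcauchy : ∀ n i, cutDist (D n).1 (D (n + i)).1 ≤ 2 * (1 / 2) ^ n - 2 * (1 / 2) ^ (n + i) := by
    intro n i
    induction i with
    | zero => simp [cutDist_self]
    | succ i ih =>
      have h1 := cutDist_triangle (D n).1 (D (n + i)).1 (D (n + i + 1)).1
      have h2 := hD (n + i)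
      rw [cutDist_comm] at h2
      rw [← add_assoc, pow_succ]
      linarith
  obtain ⟨l, hl, U, -, hU⟩ := exists_weakStarTendsto_subseq fun n => (D n : Graphon)
  refine ⟨k, hk, fun n => D n, U, fun n => (D n).2, ⟨fun n => D n, fun n => (D n).2, l, hl, hU⟩, ?_⟩
  have hbound : ∀ n, cutDist (D n) U ≤ 2 * (1 / 2) ^ n := by
    intro n
    refine (weakStarTendsto_const (D n : Graphon)).cutDist_le hU ?_
    filter_upwards [hl.tendsto_atTop.eventually_ge_atTop n] with i hi
    obtain ⟨m, hm⟩ := Nat.exists_eq_add_of_le hi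
    rw [hm]
    have : (0 : ℝ) ≤ 2 * (1 / 2) ^ (n + m) := by positivity
    linarith [hcauchy n m]
  refine squeeze_zero (fun n => cutDist_nonneg _ _) hbound ?_
  simpa using (tendsto_pow_atTop_nhds_zero_of_lt_one (by norm_num : (0 : ℝ) ≤ 1 / 2)
    (by norm_num)).const_mul 2

/-- A cut norm limit minimises `INT f` over the weak* limits: any such limit is also a weak* limit of
versions of the cut norm limit, and `INT f` is upper semicontinuous. -/
theorem INT_le_of_mem_ACC {f : ℝ → ℝ} (hf : ContinuousOn f (Set.Icc 0 1))
    (hfc : ConcaveOn ℝ (Set.Icc 0 1) f) {Γ D : ℕ → Graphon} {U W : Graphon}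
    (hD : ∀ n, IsVersion (D n) (Γ n)) (hU : Tendsto (fun n => cutDist (D n) U) atTop (𝓝 0))
    (hW : W ∈ ACC Γ) : INT f U ≤ INT f W := by
  obtain ⟨Γ', hΓ', l, hl, hlim⟩ := hW
  choose γ δ hγ using fun n => isVersion_iff.1 ((hΓ' n).trans (hD n).symm)
  let U' : ℕ → Graphon := fun n => U.pullback (hγ n).1.bwd
  have hU' : ∀ n, IsVersionVia (γ n) (δ n) (U' n) U := fun n => isVersionVia_pullback U (hγ n).1
  obtain ⟨m, hm, V, -, hV⟩ := exists_weakStarTendsto_subseq fun n => U' (l n)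
  have hclose : Tendsto (fun n => cutDist (Γ' n) (U' n)) atTop (𝓝 0) :=
    squeeze_zero (fun n => cutDist_nonneg _ _) (fun n => (hγ n).cutDist_le (hU' n)) hU
  have hWV : cutDist W V ≤ 0 := by
    refine le_of_forall_pos_le_add fun c hc => ?_
    rw [zero_add]
    refine (hlim.subseq hm).cutDist_le hV ?_
    exact ((hclose.comp (hl.comp hm).tendsto_atTop).eventually_lt_const hc).mono fun n hn => le_of_lt hn
  have hINT : INT f W = INT f V :=
    integral_congr_ae ((ae_eq_of_cutDist_le_zero hWV).mono fun z hz => congrArg f hz)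
  rw [hINT]
  exact WeakStarLim.le_integral_concave hf hfc hV (fun n => (U' _).lebesgueMeasurable)
    (fun n => (U' _).mem_Icc) V.lebesgueMeasurable V.mem_Icc fun n => ((hU' _).INT_eq hf).ge

end Graphon

end

theorem theorem1p3 (f : ℝ → ℝ) (hf_cont : ContinuousOn f (Set.Icc 0 1))
    (hf_conc : StrictConcaveOn ℝ (Set.Icc 0 1) f) (Γ : ℕ → Graphon) :
    (∀ W ∈ Graphon.ACC Γ, ¬ Graphon.IsCutNormAccPt Γ W →
      ∃ W' ∈ Graphon.ACC Γ, Graphon.INT f W' < Graphon.INT f W) ∧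
    (∃ k : ℕ → ℕ, StrictMono k ∧
      ∃ Wmin ∈ Graphon.ACC (fun n => Γ (k n)),
        IsGLB (Graphon.INT f '' Graphon.ACC (fun n => Γ (k n))) (Graphon.INT f Wmin)) := by
  refine ⟨fun W hW h => Graphon.exists_INT_lt_of_not_isCutNormAccPt hf_cont hf_conc hW h, ?_⟩
  obtain ⟨k, hk, D, U, hD, hU, hlim⟩ := Graphon.exists_subseq_cutDist_tendsto Γ
  refine ⟨k, hk, U, hU, IsLeast.isGLB ⟨Set.mem_image_of_mem _ hU, ?_⟩⟩
  rintro _ ⟨W, hW, rfl⟩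
  exact Graphon.INT_le_of_mem_ACC hf_cont hf_conc.concaveOn hD hlim hW
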